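/- All graphs are finite, undirected and simple. A model graph $H$ is a graph on the four vertices (labels) $A,B,C,D$, each of whose edges is of exactly one of two types, full or dotted. An $H$-partition of a graph $G$ is a partition of $V(G)$ into four nonempty classes $V_A,V_B,V_C,V_D$ such that, for all labels $p\neq q$, every vertex of $V_p$ is adjacent to every vertex of $V_q$ if $pq$ is a full edge of $H$, and every vertex of $V_p$ is nonadjacent to every vertex of $V_q$ if $pq$ is a dotted edge of $H$. For fixed $H$, the problem $H\text{-PARTITION}(H)$ asks whether a given graph $G$ admits an $H$-partition. A property of graphs is expressible in Datalog with stratified negation if there is a single finite, safe (range-restricted), stratified Datalog program with a nullary predicate $\mathrm{goal}$ such that, for every graph $G$, whose vertices (named by arbitrary distinct constants) are stored in a unary relation $\mathrm{vert}$ and whose edges are stored in a symmetric binary relation $e$, the stratified semantics of the program derives $\mathrm{goal}()$ if and only if $G$ has the property. Call two model graphs equivalent if one is obtained from the other by renaming the vertices, possibly followed by interchanging full and dotted edges. **Theorem.** Let $H$ be a model graph that is not equivalent to any of: $2K_2$ (two disjoint full edges and nothing else), $K_2+S_2$ (a full edge, a disjoint dotted edge and nothing else), and the 4-cycle of full edges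 with no further edge. 1. $H\text{-PARTITION}(H)$ is expressible in Datalog with stratified negation. 2. Suppose moreover that $H$ is not equivalent to a 4-cycle of full edges together with (i) one dotted diagonal and no other diagonal, (ii) one dotted and one full diagonal, or (iii) two dotted diagonals. Then the following program is a safe stratified program that decides $H\text{-PARTITION}(H)$, with goal $\mathrm{yes\_instance}$. Its facts are $\mathrm{full}(p,q)$ and $\mathrm{dotted}(p,q)$ for the full and the dotted edges $pq$ of $H$, in both orientations. Below, $\bar b$ abbreviates the four variables $I,J,K,L$, where $I,J,K,L$ belong to the labels $a,b,c,d$ respectively; rules written with a label $p$ or labels $p,q$ stand for one rule for every choice of labels; and $Z_p$ is the variable of $\bar b$ that belongs to $p$. - $\mathrm{eq}(X,X)\leftarrow \mathrm{vert}(X)$; $\ \mathrm{distinct}(\bar b)\leftarrow \mathrm{vert}(I),\mathrm{vert}(J),\mathrm{vert}(K),\mathrm{vert}(L)$ and $\mathrm{not}\ \mathrm{eq}(Z_p,Z_q)$ for all six pairs $p<q$; - $\mathrm{problematic\_base}(\bar b)\leftarrow \mathrm{dotted}(p,q), e(Z_p,Z_q),\mathrm{vert}(I),\mathrm{vert}(J),\mathrm{vert}(K),\mathrm{vert}(L)$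 and $\mathrm{problematic\_base}(\bar b)\leftarrow \mathrm{full}(p,q), \mathrm{not}\ e(Z_p,Z_q),\mathrm{vert}(I),\mathrm{vert}(J),\mathrm{vert}(K),\mathrm{vert}(L)$, for $p<q$; - $\mathrm{base}(\bar b)\leftarrow \mathrm{distinct}(\bar b),\mathrm{not}\ \mathrm{problematic\_base}(\bar b)$; - $\mathrm{inPart}(Z_p,p,\bar b)\leftarrow \mathrm{base}(\bar b)$; $\ \mathrm{done}(Z_p,\bar b)\leftarrow \mathrm{base}(\bar b)$; - $\mathrm{imp}(X,P,\bar b)\leftarrow \mathrm{vert}(X),\mathrm{full\_prob}(X,P,\bar b),\mathrm{not}\ \mathrm{done}(X,\bar b)$; $\ \mathrm{imp}(X,P,\bar b)\leftarrow \mathrm{vert}(X),\mathrm{dot\_prob}(X,P,\bar b),\mathrm{not}\ \mathrm{done}(X,\bar b)$; - $\mathrm{full\_prob}(X,P,\bar b)\leftarrow \mathrm{full}(P,Q),\mathrm{inPart}(Y,Q,\bar b),\mathrm{not}\ e(X,Y),\mathrm{vert}(X)$; $\ \mathrm{dot\_prob}(X,P,\bar b)\leftarrow \mathrm{dotted}(P,Q),\mathrm{inPart}(Y,Q,\bar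 b), e(X,Y)$; - $\mathrm{inPart}(X,p,\bar b)\leftarrow \mathrm{imp}(X,q_1,\bar b),\mathrm{imp}(X,q_2,\bar b),\mathrm{imp}(X,q_3,\bar b)$, where $q_1,q_2,q_3$ are the labels other than $p$; - $\mathrm{bad\_init}(\bar b)\leftarrow \mathrm{vert}(X),\mathrm{base}(\bar b),\mathrm{imp}(X,a,\bar b),\mathrm{imp}(X,b,\bar b),\mathrm{imp}(X,c,\bar b),\mathrm{imp}(X,d,\bar b)$; - $\mathrm{yes\_instance}()\leftarrow \mathrm{base}(\bar b),\mathrm{not}\ \mathrm{bad\_init}(\bar b)$; $\ \mathrm{no\_instance}()\leftarrow \mathrm{not}\ \mathrm{yes\_instance}()$. -/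

import Mathlib

/-! ## Datalog with stratified negation over undirected graphs -/

namespace Datalog

/-- Terms: variables, and constants from the countably infinite domain `ℕ`. -/
inductive Term where
  | var (n : ℕ)
  | const (c : ℕ)

/-- Value of a term under a valuation of the variables. -/
def Term.eval (s : ℕ → ℕ) : Term → ℕ
  | .var n => s n
  | .const c => c

/-- Relation symbols available to a program with intensional symbols `I`: the extensional symbols
`vert` (unary, the vertices) and `edge` (binary, the edges) of the input graph, and the symbols
of `I`. -/
inductive Pred (I : Type) where
  | vert
  | edge
  | idb (i : I)

/-- Arities, given the arities `ar` of the intensional symbols. -/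
def Pred.arity {I : Type} (ar : I → ℕ) : Pred I → ℕ
  | .vert => 1
  | .edge => 2
  | .idb i => ar i

/-- An atom `R(t₁, …, tₖ)`, with `k` the arity of `R`. -/
structure Atom {I : Type} (ar : I → ℕ) where
  rel : Pred I
  args : Fin (rel.arity ar) → Term

/-- A ground fact `R(c₁, …, cₖ)`. -/
abbrev Fact {I : Type} (ar : I → ℕ) : Type := Σ R : Pred I, (Fin (R.arity ar) → ℕ)

/-- The instance of an atom under a valuation. -/
def Atom.ground {I : Type} {ar : I → ℕ} (a : Atom ar) (s : ℕ → ℕ) : Fact ar :=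
  ⟨a.rel, fun n => (a.args n).eval s⟩

/-- A variable occurs in an atom. -/
def Atom.HasVar {I : Type} {ar : I → ℕ} (a : Atom ar) (x : ℕ) : Prop :=
  ∃ n, a.args n = .var x

/-- A rule `R(t₁, …, tₖ) :- pos₁, …, posₘ, not neg₁, …, not negₙ` with intensional `R`. -/
structure Rule {I : Type} (ar : I → ℕ) where
  headRel : I
  headArgs : Fin (ar headRel) → Term
  pos : List (Atom ar)
  neg : List (Atom ar)

/-- The head of a rule. -/
def Rule.head {I : Type} {ar : I → ℕ} (r : Rule ar) : Atom ar := ⟨.idb r.headRel, r.headArgs⟩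

/-- Safety (range restriction): each variable of the rule occurs in a positive body atom. -/
def Rule.Safe {I : Type} {ar : I → ℕ} (r : Rule ar) : Prop :=
  ∀ x, (r.head.HasVar x ∨ ∃ a ∈ r.neg, a.HasVar x) → ∃ a ∈ r.pos, a.HasVar x

/-- A program is a finite list of rules. -/
abbrev Program {I : Type} (ar : I → ℕ) : Type := List (Rule ar)

/-- `lv` is a stratification of `P`: an intensional symbol that occurs positively in the body of a
rule has at most the level of the head, and one that occurs negatively has a smaller level. -/
def IsStratification {I : Type} {ar : I → ℕ} (P : Program ar) (lv : I → ℕ) : Prop :=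
  ∀ r ∈ P,
    (∀ a ∈ r.pos, ∀ i, a.rel = .idb i → lv i ≤ lv r.headRel) ∧
    (∀ a ∈ r.neg, ∀ i, a.rel = .idb i → lv i < lv r.headRel)

/-- Result of evaluating a set of rules on a set `D` of facts, negated atoms being evaluated in
`D` (semipositive evaluation): the least set of facts containing `D` and closed under the rules. -/
inductive Derives {I : Type} {ar : I → ℕ} (R : Set (Rule ar)) (D : Set (Fact ar)) :
    Fact ar → Prop
  | input (x : Fact ar) (hx : x ∈ D) : Derives R D x
  | rule (r : Rule ar) (s : ℕ → ℕ) (hr : r ∈ R)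
      (hpos : ∀ a ∈ r.pos, Derives R D (a.ground s))
      (hneg : ∀ a ∈ r.neg, a.ground s ∉ D) :
      Derives R D (r.head.ground s)

/-- Evaluation stratum by stratum: `stage P lv D n` is the result of evaluating, on input `D`, the
strata `0, …, n - 1` in this order. -/
def stage {I : Type} {ar : I → ℕ} (P : Program ar) (lv : I → ℕ) (D : Set (Fact ar)) :
    ℕ → Set (Fact ar)
  | 0 => D
  | n + 1 => {x | Derives {r | r ∈ P ∧ lv r.headRel = n} (stage P lv D n) x}

/-- The stratified semantics of `P` on input `D`. -/
def model {I : Type} {ar : I → ℕ} (P : Program ar) (lv : I → ℕ) (D : Set (Fact ar)) :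
    Set (Fact ar) :=
  ⋃ n, stage P lv D n

/-- The facts that store a graph `G` whose vertices are named by distinct elements of the domain:
`vert(v)` for all vertices, and `edge(u, v)`, `edge(v, u)` for all edges. -/
def graphFacts {I : Type} (ar : I → ℕ) {V : Type} (G : SimpleGraph V) (name : V ↪ ℕ) :
    Set (Fact ar) :=
  {x | (∃ v, x = ⟨.vert, ![name v]⟩) ∨ ∃ u v, G.Adj u v ∧ x = ⟨.edge, ![name u, name v]⟩}

/-- `P` is a safe stratified program that decides the property `Q` of finite simple graphs: on
every input graph, the nullary symbol `goal` is derived if and only if the graph has `Q`. -/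
def StratifiedDecides {I : Type} {ar : I → ℕ} (P : Program ar) (goal : I)
    (Q : ∀ V : Type, SimpleGraph V → Prop) : Prop :=
  ar goal = 0 ∧ (∀ r ∈ P, r.Safe) ∧
  ∃ lv : I → ℕ, IsStratification P lv ∧
    ∀ (V : Type) [Finite V] (G : SimpleGraph V) (name : V ↪ ℕ),
      (∃ t, (⟨.idb goal, t⟩ : Fact ar) ∈ model P lv (graphFacts ar G name)) ↔ Q V G

/-- A property of finite simple graphs is expressible in Datalog with stratified negation. -/
def Expressible (Q : ∀ V : Type, SimpleGraph V → Prop) : Prop :=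
  ∃ (I : Type) (_ : Finite I) (ar : I → ℕ) (P : Program ar) (goal : I), StratifiedDecides P goal Q

end Datalog

/-! ## Model graphs and `H`-partitions -/

/-- The two types of edges of a model graph. -/
inductive EdgeKind where
  | full
  | dotted

/-- Interchange of the two types of edges. -/
def EdgeKind.swap : EdgeKind → EdgeKind
  | .full => .dotted
  | .dotted => .full

/-- A model graph: an undirected simple graph on the four vertices (labels) `A = 0`, `B = 1`,
`C = 2`, `D = 3`, each of whose edges is either full or dotted; `none` means that there is no
edge. -/
structure ModelGraph where
  edge : Fin 4 → Fin 4 → Option EdgeKind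
  symm : ∀ p q, edge p q = edge q p
  loopless : ∀ p, edge p p = none

namespace ModelGraph

/-- The labeling `f` is an `H`-partition of `G`: the four classes (the fibres of `f`) are nonempty,
classes joined by a full edge are completely adjacent, and classes joined by a dotted edge are
completely nonadjacent. -/
def IsPartition (H : ModelGraph) {V : Type} (G : SimpleGraph V) (f : V → Fin 4) : Prop :=
  Function.Surjective f ∧
  (∀ u v, H.edge (f u) (f v) = some .full → G.Adj u v) ∧
  (∀ u v, H.edge (f u) (f v) = some .dotted → ¬ G.Adj u v)

/-- The problem `H-PARTITION(H)`: the input graph admits an `H`-partition. -/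
def HPartition (H : ModelGraph) (V : Type) (G : SimpleGraph V) : Prop :=
  ∃ f : V → Fin 4, H.IsPartition G f

/-- The model graph with prescribed edges `AB`, `AC`, `AD`, `BC`, `BD`, `CD`. -/
def mk6 (ab ac ad bc bd cd : Option EdgeKind) : ModelGraph where
  edge := ![![none, ab, ac, ad], ![ab, none, bc, bd], ![ac, bc, none, cd], ![ad, bd, cd, none]]
  symm := by intro p q; fin_cases p <;> fin_cases q <;> rfl
  loopless := by intro p; fin_cases p <;> rfl

/-- `2K₂`: two disjoint full edges. -/
def twoK2 : ModelGraph := mk6 (some .full) none none none none (some .full)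

/-- `K₂ + S₂`: a full edge and a disjoint dotted edge. -/
def k2S2 : ModelGraph := mk6 (some .full) none none none none (some .dotted)

/-- The full 4-cycle `A B C D`, together with the diagonals `AC` of type `x` and `BD` of type
`y`. -/
def fullCycle (x y : Option EdgeKind) : ModelGraph :=
  mk6 (some .full) x (some .full) (some .full) y (some .full)

/-- `H` and `K` are the same up to a renaming of the vertices, possibly combined with the
interchange of full and dotted edges (that is, complementation of the input graph). -/
def Equivalent (H K : ModelGraph) : Prop :=
  ∃ π : Equiv.Perm (Fin 4),
    (∀ p q, H.edge (π p) (π q) = K.edge p q) ∨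
    (∀ p q, H.edge (π p) (π q) = (K.edge p q).map EdgeKind.swap)

end ModelGraph

/-! ## The general program: bases and propagation of impossible labels -/

namespace GeneralProgram

open Datalog

/-- The intensional symbols of the program. -/
inductive Sym where
  | full | dotted | eq | distinct | problematicBase | base | inPart | done | imp
  | fullProb | dotProb | badInit | yesInstance | noInstance

/-- Their arities. -/
abbrev arity : Sym → ℕ
  | .full => 2
  | .dotted => 2
  | .eq => 2
  | .distinct => 4
  | .problematicBase => 4
  | .base => 4
  | .inPart => 6
  | .done => 5
  | .imp => 6
  | .fullProb => 6
  | .dotProb => 6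
  | .badInit => 4
  | .yesInstance => 0
  | .noInstance => 0

/-- The variables `I, J, K, L` of the base, as the variable for the vertex labeled `p`. -/
def bv (p : Fin 4) : Term := .var p

/-- The label `p` as a constant: `a = 0`, `b = 1`, `c = 2`, `d = 3`. -/
def lab (p : Fin 4) : Term := .const p

/-- The variable `X`. -/
def vX : Term := .var 4
/-- The variable `Y`. -/
def vY : Term := .var 5
/-- The variable `P`. -/
def vP : Term := .var 6
/-- The variable `Q`. -/
def vQ : Term := .var 7

/-- `vert(x)` -/
def vert (x : Term) : Atom arity := ⟨.vert, ![x]⟩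
/-- `e(x, y)` -/
def e (x y : Term) : Atom arity := ⟨.edge, ![x, y]⟩
/-- `full(p, q)` -/
def full (p q : Term) : Atom arity := ⟨.idb .full, ![p, q]⟩
/-- `dotted(p, q)` -/
def dotted (p q : Term) : Atom arity := ⟨.idb .dotted, ![p, q]⟩
/-- `eq(x, y)` -/
def eq (x y : Term) : Atom arity := ⟨.idb .eq, ![x, y]⟩
/-- `distinct(I, J, K, L)` -/
def distinct : Atom arity := ⟨.idb .distinct, ![bv 0, bv 1, bv 2, bv 3]⟩
/-- `problematic_base(I, J, K, L)` -/
def problematicBase : Atom arity := ⟨.idb .problematicBase, ![bv 0, bv 1, bv 2, bv 3]⟩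
/-- `base(I, J, K, L)` -/
def base : Atom arity := ⟨.idb .base, ![bv 0, bv 1, bv 2, bv 3]⟩
/-- `inPart(x, p, I, J, K, L)` -/
def inPart (x p : Term) : Atom arity := ⟨.idb .inPart, ![x, p, bv 0, bv 1, bv 2, bv 3]⟩
/-- `done(x, I, J, K, L)` -/
def done (x : Term) : Atom arity := ⟨.idb .done, ![x, bv 0, bv 1, bv 2, bv 3]⟩
/-- `imp(x, p, I, J, K, L)` -/
def imp (x p : Term) : Atom arity := ⟨.idb .imp, ![x, p, bv 0, bv 1, bv 2, bv 3]⟩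
/-- `full_prob(x, p, I, J, K, L)` -/
def fullProb (x p : Term) : Atom arity := ⟨.idb .fullProb, ![x, p, bv 0, bv 1, bv 2, bv 3]⟩
/-- `dot_prob(x, p, I, J, K, L)` -/
def dotProb (x p : Term) : Atom arity := ⟨.idb .dotProb, ![x, p, bv 0, bv 1, bv 2, bv 3]⟩
/-- `bad_init(I, J, K, L)` -/
def badInit : Atom arity := ⟨.idb .badInit, ![bv 0, bv 1, bv 2, bv 3]⟩
/-- `yes_instance()` -/
def yesInstance : Atom arity := ⟨.idb .yesInstance, ![]⟩

/-- The four labels. -/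
def labels : List (Fin 4) := [0, 1, 2, 3]
/-- The pairs `p < q` of labels. -/
def pairs : List (Fin 4 × Fin 4) := [(0, 1), (0, 2), (0, 3), (1, 2), (1, 3), (2, 3)]

/-- `full(p, q).` and `dotted(p, q).` for the full and the dotted edges of `H`, in both
orientations. -/
def modelFacts (H : ModelGraph) : Program arity :=
  labels.flatMap fun p => labels.flatMap fun q =>
    match H.edge p q with
    | none => []
    | some .full => [⟨.full, ![lab p, lab q], [], []⟩]
    | some .dotted => [⟨.dotted, ![lab p, lab q], [], []⟩]

/-- The atoms `vert(I)`, `vert(J)`, `vert(K)`, `vert(L)`. -/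
def baseVerts : List (Atom arity) := labels.map fun p => vert (bv p)

/-- The rules that find a base. -/
def baseRules : Program arity :=
  [ -- eq(X,X) :- vert(X).
    ⟨.eq, ![vX, vX], [vert vX], []⟩,
    -- distinct(I,J,K,L) holds for four distinct vertices
    ⟨.distinct, ![bv 0, bv 1, bv 2, bv 3], baseVerts, pairs.map fun pq => eq (bv pq.1) (bv pq.2)⟩,
    -- base(I,J,K,L) :- distinct(I,J,K,L), not problematic_base(I,J,K,L).
    ⟨.base, ![bv 0, bv 1, bv 2, bv 3], [distinct], [problematicBase]⟩ ] ++
  (pairs.flatMap fun pq =>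
    [ -- for (p,q) = (a,b): problematic_base(I,J,K,L) :- dotted(a,b), e(I,J), vert(K), vert(L).
      ⟨.problematicBase, ![bv 0, bv 1, bv 2, bv 3],
        [dotted (lab pq.1) (lab pq.2), e (bv pq.1) (bv pq.2)] ++ baseVerts, []⟩,
      -- for (p,q) = (a,b): problematic_base(I,J,K,L) :- full(a,b), not e(I,J), vert(I), ...
      ⟨.problematicBase, ![bv 0, bv 1, bv 2, bv 3],
        [full (lab pq.1) (lab pq.2)] ++ baseVerts, [e (bv pq.1) (bv pq.2)]⟩ ])

/-- The rules that label the vertices of a base, and mark them as done. -/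
def initRules : Program arity :=
  labels.flatMap fun p =>
    [ -- inPart(I,a,I,J,K,L) :- base(I,J,K,L).
      ⟨.inPart, ![bv p, lab p, bv 0, bv 1, bv 2, bv 3], [base], []⟩,
      -- done(I,I,J,K,L) :- base(I,J,K,L).
      ⟨.done, ![bv p, bv 0, bv 1, bv 2, bv 3], [base], []⟩ ]

/-- The rules that compute impossible labels. -/
def impRules : Program arity :=
  [ -- imp(X,P,I,J,K,L) :- vert(X), full_prob(X,P,I,J,K,L), not done(X,I,J,K,L).
    ⟨.imp, ![vX, vP, bv 0, bv 1, bv 2, bv 3], [vert vX, fullProb vX vP], [done vX]⟩,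
    -- full_prob(X,P,I,J,K,L) :- full(P,Q), inPart(Y,Q,I,J,K,L), not e(X,Y), vert(X).
    ⟨.fullProb, ![vX, vP, bv 0, bv 1, bv 2, bv 3],
      [full vP vQ, inPart vY vQ, vert vX], [e vX vY]⟩,
    -- imp(X,P,I,J,K,L) :- vert(X), dot_prob(X,P,I,J,K,L), not done(X,I,J,K,L).
    ⟨.imp, ![vX, vP, bv 0, bv 1, bv 2, bv 3], [vert vX, dotProb vX vP], [done vX]⟩,
    -- dot_prob(X,P,I,J,K,L) :- dotted(P,Q), inPart(Y,Q,I,J,K,L), e(X,Y).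
    ⟨.dotProb, ![vX, vP, bv 0, bv 1, bv 2, bv 3],
      [dotted vP vQ, inPart vY vQ, e vX vY], []⟩ ]

/-- A vertex for which the three other labels are impossible gets the fourth label. -/
def propagationRules : Program arity :=
  [ ⟨.inPart, ![vX, lab 0, bv 0, bv 1, bv 2, bv 3],
      [imp vX (lab 1), imp vX (lab 2), imp vX (lab 3)], []⟩,
    ⟨.inPart, ![vX, lab 1, bv 0, bv 1, bv 2, bv 3],
      [imp vX (lab 0), imp vX (lab 2), imp vX (lab 3)], []⟩,
    ⟨.inPart, ![vX, lab 2, bv 0, bv 1, bv 2, bv 3],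
      [imp vX (lab 0), imp vX (lab 1), imp vX (lab 3)], []⟩,
    ⟨.inPart, ![vX, lab 3, bv 0, bv 1, bv 2, bv 3],
      [imp vX (lab 0), imp vX (lab 1), imp vX (lab 2)], []⟩ ]

/-- The rules that give the answer. -/
def answerRules : Program arity :=
  [ -- bad_init(I,J,K,L) :- vert(X), base(I,J,K,L), imp(X,a,...), ..., imp(X,d,...).
    ⟨.badInit, ![bv 0, bv 1, bv 2, bv 3],
      [vert vX, base, imp vX (lab 0), imp vX (lab 1), imp vX (lab 2), imp vX (lab 3)], []⟩,
    -- yes_instance() :- base(I,J,K,L), not bad_init(I,J,K,L).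
    ⟨.yesInstance, ![], [base], [badInit]⟩,
    -- no_instance() :- not yes_instance().
    ⟨.noInstance, ![], [], [yesInstance]⟩ ]

/-- The general program for the model graph `H`. -/
def program (H : ModelGraph) : Program arity :=
  modelFacts H ++ baseRules ++ initRules ++ impRules ++ propagationRules ++ answerRules

end GeneralProgram

/-! ## Stratified semantics: closure and induction -/

namespace Datalog

variable {I : Type} {ar : I → ℕ} {P : Program ar} {lv : I → ℕ} {D : Set (Fact ar)}

/-! The general program guesses one vertex of each class (a base without conflicts) and propagates.
A label is impossible for a vertex if it conflicts with a labeled vertex, and a vertex with three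
impossible labels gets the fourth. If the base is taken from a genuine partition `f`, then every
derived label is the one given by `f`, and the label `f x` never becomes impossible for `x`
(`correct_consequences`), so the base is not bad.

Conversely, suppose that no vertex loses all four labels. The labeled vertices fit together, and
only the undecided ones need an idea. A universal set `S` consists of labels that are pairwise
nonadjacent in `H`, such that an undecided vertex always keeps some label of `S`. Give each
undecided vertex such a label. Two undecided vertices cannot conflict, because `H` has no edge
inside `S`; an undecided and a labeled vertex cannot conflict, because the chosen label is not
impossible. This is `Propagation.hPartition`. Such a set exists for all model graphs outside six
equivalence classes, by a finite check over the `3 ^ 6` model graphs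
(`universalTest_or_equivalentTest`).

Three of the six classes are excluded by hypothesis. The other three are `fullCycle k (some
.dotted)`, where the graph is a join of `A ∪ C` with `B ∪ D` and `B`, `D` are mutually nonadjacent.
Then `B ∪ D` is connected in the complement and complete to the rest, hence it is a component of the
complement, and it is disconnected in the graph. Conversely, any complement component that is
disconnected in the graph can serve as `B ∪ D`, and what remains is a simple condition on the other
side that depends on `k` (`hPartition_fullCycle_dotted_iff`). Both kinds of connectivity are
reachability relations, so Datalog computes them, and negation is applied in later strata. When full
and dotted edges are interchanged, the same program works on the complement. -/

theorem stage_mono {m n : ℕ} (h : m ≤ n) : stage P lv D m ⊆ stage P lv D n := by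
  induction n, h using Nat.le_induction with
  | base => exact subset_rfl
  | succ n _ ih => exact fun x hx => Derives.input x (ih hx)

theorem stage_subset_model (n : ℕ) : stage P lv D n ⊆ model P lv D :=
  Set.subset_iUnion (stage P lv D) n

theorem subset_model : D ⊆ model P lv D := stage_subset_model 0

/-- The symbols of level less than `n` are completely evaluated by the first `n` strata. -/
theorem mem_stage_of_mem_model {n : ℕ} {x : Fact ar} (hx : x ∈ model P lv D)
    (h : ∀ i, x.1 = .idb i → lv i < n) : x ∈ stage P lv D n := by
  obtain ⟨m, hm⟩ := Set.mem_iUnion.1 hx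
  rcases le_total m n with hmn | hmn
  · exact stage_mono hmn hm
  · induction m, hmn using Nat.le_induction with
    | base => exact hm
    | succ m hmn ih =>
      cases hm with
      | input _ hx => exact ih hx
      -- A fact added by stratum `m` has level `m ≥ n`, which the level bound rules out.
      | rule r s hr _ _ =>
        have := h r.headRel rfl
        have := hr.2
        omega

/-- The stratified model is closed under the rules of the program. -/
theorem head_mem_model (hP : IsStratification P lv) {r : Rule ar} (hr : r ∈ P) (s : ℕ → ℕ)
    (hpos : ∀ a ∈ r.pos, a.ground s ∈ model P lv D)
    (hneg : ∀ a ∈ r.neg, a.ground s ∉ model P lv D) :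
    r.head.ground s ∈ model P lv D :=
  stage_subset_model (lv r.headRel + 1) <|
    Derives.rule r s ⟨hr, rfl⟩
      (fun a ha => mem_stage_of_mem_model (hpos a ha) fun i hi =>
        Nat.lt_succ_of_le ((hP r hr).1 a ha i hi))
      (fun a ha h => hneg a ha (stage_subset_model _ h))

/-- Induction over the stratified model: negated atoms are known to fail in the model. -/
theorem model_induction (hP : IsStratification P lv) {Q : Fact ar → Prop}
    (hD : ∀ x ∈ D, Q x)
    (hQ : ∀ r ∈ P, ∀ s, (∀ a ∈ r.pos, a.ground s ∈ model P lv D ∧ Q (a.ground s)) →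
      (∀ a ∈ r.neg, a.ground s ∉ model P lv D) → Q (r.head.ground s))
    {x : Fact ar} (hx : x ∈ model P lv D) : Q x := by
  obtain ⟨n, hn⟩ := Set.mem_iUnion.1 hx
  clear hx
  induction n generalizing x with
  | zero => exact hD x hn
  | succ n ih =>
    -- Membership in the stage is carried along with `Q`, since `hQ` also wants the positive atoms
    -- to lie in the model.
    have key : x ∈ stage P lv D (n + 1) ∧ Q x := by
      induction hn with
      | input x hx => exact ⟨Derives.input x hx, ih hx⟩
      | rule r s hr hpos hneg ihp =>
        refine ⟨Derives.rule r s hr hpos hneg, hQ r hr.1 s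
          (fun a ha => ⟨stage_subset_model _ (ihp a ha).1, (ihp a ha).2⟩) fun a ha h => ?_⟩
        -- A negated symbol has level below `n`, so it is completely evaluated at stage `n`: absence
        -- there is absence from the model.
        exact hneg a ha (mem_stage_of_mem_model h fun i hi => by
          have := (hP r hr.1).2 a ha i hi
          have := hr.2
          omega)
    exact key.2

/-- Fixing `R` avoids heterogeneous equality of the argument tuples; with `R` concrete, the index
type can be ascribed as `Fin` of a numeral and treated by cases. -/
theorem fact_ext {R : Pred I} {v w : Fin (R.arity ar) → ℕ} (h : ∀ n, v n = w n) :
    (⟨R, v⟩ : Fact ar) = ⟨R, w⟩ := by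
  rw [funext h]

/-! ### Extensional facts in the model. -/

section graphFacts

variable {V : Type} {G : SimpleGraph V} {name : V ↪ ℕ}

theorem vert_mem_graphFacts {x : ℕ} :
    (⟨.vert, ![x]⟩ : Fact ar) ∈ graphFacts ar G name ↔ ∃ v, name v = x := by
  constructor
  · rintro (⟨v, h⟩ | ⟨u, v, _, h⟩)
    · obtain ⟨_, h⟩ := Sigma.mk.inj h
      exact ⟨v, (congrFun (eq_of_heq h) (0 : Fin 1)).symm⟩
    · cases congrArg Sigma.fst h
  · rintro ⟨v, rfl⟩
    exact Or.inl ⟨v, rfl⟩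

theorem edge_mem_graphFacts {x y : ℕ} :
    (⟨.edge, ![x, y]⟩ : Fact ar) ∈ graphFacts ar G name ↔
      ∃ u v, G.Adj u v ∧ name u = x ∧ name v = y := by
  constructor
  · rintro (⟨v, h⟩ | ⟨u, v, huv, h⟩)
    · cases congrArg Sigma.fst h
    · obtain ⟨_, h⟩ := Sigma.mk.inj h
      exact ⟨u, v, huv, (congrFun (eq_of_heq h) (0 : Fin 2)).symm,
        (congrFun (eq_of_heq h) (1 : Fin 2)).symm⟩
  · rintro ⟨u, v, h, rfl, rfl⟩
    exact Or.inr ⟨u, v, h, rfl⟩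

/-- The rules derive no facts about the extensional symbols. -/
theorem mem_of_mem_model {x : Fact ar} (hx : x ∈ model P lv D) (h : ∀ i, x.1 ≠ .idb i) :
    x ∈ D :=
  mem_stage_of_mem_model (n := 0) hx fun i hi => absurd hi (h i)

theorem vert_mem_model {x : ℕ} :
    (⟨.vert, ![x]⟩ : Fact ar) ∈ model P lv (graphFacts ar G name) ↔ ∃ v, name v = x :=
  Iff.trans ⟨fun h => mem_of_mem_model h fun _ h => (by cases h), fun h => subset_model h⟩
    vert_mem_graphFacts

theorem edge_mem_model {x y : ℕ} :
    (⟨.edge, ![x, y]⟩ : Fact ar) ∈ model P lv (graphFacts ar G name) ↔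
      ∃ u v, G.Adj u v ∧ name u = x ∧ name v = y :=
  Iff.trans ⟨fun h => mem_of_mem_model h fun _ h => (by cases h), fun h => subset_model h⟩
    edge_mem_graphFacts

end graphFacts

end Datalog

/-! ## Labels that serve all undecided vertices -/

namespace ModelGraph

/-- The label `p` is excluded for a vertex that is adjacent to the decided vertices labeled `q`
as `t q` tells: to all of them (`some .full`), to none (`some .dotted`), or otherwise (`none`). -/
def Excludes (H : ModelGraph) (t : Fin 4 → Option EdgeKind) (p : Fin 4) : Prop :=
  ∃ q, H.edge p q ≠ none ∧ H.edge p q ≠ t q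

/-- The labels in `S` are pairwise nonadjacent in `H`, and a vertex for which all of them are
excluded has at most one label left. -/
def IsUniversal (H : ModelGraph) (S : Fin 4 → Bool) : Prop :=
  (∀ p q, S p = true → S q = true → H.edge p q = none) ∧
  ∀ t, (∀ p, S p = true → H.Excludes t p) → ∃ p, ∀ q, q ≠ p → H.Excludes t q

/-! ### Reduction of universality to a finite check on six edge types. -/

theorem eq_mk6 (H : ModelGraph) :
    H = mk6 (H.edge 0 1) (H.edge 0 2) (H.edge 0 3) (H.edge 1 2) (H.edge 1 3) (H.edge 2 3) := by
  rcases H with ⟨e, hs, hl⟩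
  congr 1
  funext p q
  fin_cases p <;> fin_cases q <;> simp [hl, hs 1 0, hs 2 0, hs 3 0, hs 2 1, hs 3 1, hs 3 2]

/-- Test a property of all edge types. -/
def allKinds (f : Option EdgeKind → Bool) : Bool := f none && f (some .full) && f (some .dotted)

theorem allKinds_eq_true {f : Option EdgeKind → Bool} : allKinds f = true ↔ ∀ x, f x = true := by
  constructor
  · intro h x
    simp only [allKinds, Bool.and_eq_true] at h
    rcases x with _ | _ | _
    exacts [h.1.1, h.1.2, h.2]
  · intro h
    simp [allKinds, h]

/-- Test whether some truth value has a property. -/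
def anyBool (f : Bool → Bool) : Bool := f false || f true

theorem anyBool_eq_true {f : Bool → Bool} : anyBool f = true ↔ ∃ x, f x = true := by
  simp [anyBool]

/-- An edge of type `x` excludes a label, in the presence of the adjacency type `y`. -/
def clash : Option EdgeKind → Option EdgeKind → Bool
  | none, _ => false
  | some .full, some .full => false
  | some .dotted, some .dotted => false
  | _, _ => true

theorem clash_eq_true {x y : Option EdgeKind} : clash x y = true ↔ x ≠ none ∧ x ≠ y := by
  rcases x with _ | _ | _ <;> rcases y with _ | _ | _ <;> simp [clash]

/-- Boolean test whether `x` is an edge. -/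
def isEdge : Option EdgeKind → Bool
  | none => false
  | _ => true

/-- Boolean form of `IsUniversal`. -/
def universalTest (ab ac ad bc bd cd : Option EdgeKind) (a b c d : Bool) : Bool :=
  !(a && b && isEdge ab) && !(a && c && isEdge ac) && !(a && d && isEdge ad) &&
  !(b && c && isEdge bc) && !(b && d && isEdge bd) && !(c && d && isEdge cd) &&
  allKinds fun ta => allKinds fun tb => allKinds fun tc => allKinds fun td =>
    -- `xa` tells whether the label `A` is excluded by the type `ta, tb, tc, td`, and so on. The
    -- disjunction below says that either a label of the chosen set survives or three labels are
    -- excluded.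
    let xa := clash ab tb || clash ac tc || clash ad td
    let xb := clash ab ta || clash bc tc || clash bd td
    let xc := clash ac ta || clash bc tb || clash cd td
    let xd := clash ad ta || clash bd tb || clash cd tc
    (a && !xa) || (b && !xb) || (c && !xc) || (d && !xd) ||
    (xb && xc && xd) || (xa && xc && xd) || (xa && xb && xd) || (xa && xb && xc)

/-- Boolean test for equality of edge types. -/
def sameKind : Option EdgeKind → Option EdgeKind → Bool
  | none, none => true
  | some .full, some .full => true
  | some .dotted, some .dotted => true
  | _, _ => false

/-- Test whether some label has a property. -/
def anyLabel (f : Fin 4 → Bool) : Bool := f 0 || f 1 || f 2 || f 3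

theorem anyLabel_eq_true {f : Fin 4 → Bool} : anyLabel f = true ↔ ∃ p, f p = true := by
  simp [anyLabel, Fin.exists_fin_succ, or_assoc]

/-- Test whether `a, b, c, d` is a listing of the labels that identifies `H` with `K`, up to the
map `s` on edge types. -/
def listingTest (H K : ModelGraph) (s : Option EdgeKind → Option EdgeKind) (a b c d : Fin 4) :
    Bool :=
  a != b && a != c && a != d && b != c && b != d && c != d &&
  sameKind (H.edge a b) (s (K.edge 0 1)) && sameKind (H.edge a c) (s (K.edge 0 2)) &&
  sameKind (H.edge a d) (s (K.edge 0 3)) && sameKind (H.edge b c) (s (K.edge 1 2)) &&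
  sameKind (H.edge b d) (s (K.edge 1 3)) && sameKind (H.edge c d) (s (K.edge 2 3))

/-- Boolean form of `Equivalent`. -/
def equivalentTest (H K : ModelGraph) : Bool :=
  anyLabel fun a => anyLabel fun b => anyLabel fun c => anyLabel fun d =>
    listingTest H K id a b c d || listingTest H K (Option.map EdgeKind.swap) a b c d

theorem sameKind_eq_true {x y : Option EdgeKind} : sameKind x y = true ↔ x = y := by
  rcases x with _ | _ | _ <;> rcases y with _ | _ | _ <;> simp [sameKind]

/-- The map `s` is the identity or the interchange of edge types, so one proof covers both forms of
equivalence. The condition `s none = none` takes care of the diagonal, which the test does not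
inspect. -/
theorem exists_perm_of_listingTest {H K : ModelGraph} {s : Option EdgeKind → Option EdgeKind}
    (hs : s none = none) {a b c d : Fin 4} (h : listingTest H K s a b c d = true) :
    ∃ π : Equiv.Perm (Fin 4), ∀ p q, H.edge (π p) (π q) = s (K.edge p q) := by
  simp only [listingTest, Bool.and_eq_true, bne_iff_ne, sameKind_eq_true, and_assoc] at h
  obtain ⟨h1, h2, h3, h4, h5, h6, e1, e2, e3, e4, e5, e6⟩ := h
  have hinj : Function.Injective ![a, b, c, d] := by
    intro p q
    fin_cases p <;> fin_cases q <;> simp [*, Ne.symm]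
  refine ⟨Equiv.ofBijective _ (Finite.injective_iff_bijective.1 hinj), fun p q => ?_⟩
  rw [Equiv.ofBijective_apply, Equiv.ofBijective_apply]
  fin_cases p <;> fin_cases q <;>
    simp [H.loopless, K.loopless, hs, e1, e2, e3, e4, e5, e6, H.symm b a, H.symm c a, H.symm d a,
      H.symm c b, H.symm d b, H.symm d c, K.symm 1 0, K.symm 2 0, K.symm 3 0, K.symm 2 1,
      K.symm 3 1, K.symm 3 2]

theorem equivalent_of_test {H K : ModelGraph} (h : equivalentTest H K = true) :
    H.Equivalent K := by
  simp only [equivalentTest, anyLabel_eq_true, Bool.or_eq_true] at h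
  obtain ⟨a, b, c, d, h | h⟩ := h
  · obtain ⟨π, hπ⟩ := exists_perm_of_listingTest rfl h
    exact ⟨π, Or.inl hπ⟩
  · obtain ⟨π, hπ⟩ := exists_perm_of_listingTest rfl h
    exact ⟨π, Or.inr hπ⟩

theorem isEdge_eq_false {x : Option EdgeKind} : isEdge x = false ↔ x = none := by
  rcases x with _ | _ | _ <;> simp [isEdge]

/-- If every label of the set is hit, the first four disjuncts of the test fail, so one of the
triples is hit. -/
theorem exists_label_of_hits : ∀ a b c d xa xb xc xd : Bool,
    ((a && !xa) || (b && !xb) || (c && !xc) || (d && !xd) ||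
      (xb && xc && xd) || (xa && xc && xd) || (xa && xb && xd) || (xa && xb && xc)) = true →
    (∀ p, ![a, b, c, d] p = true → ![xa, xb, xc, xd] p = true) →
    ∃ p, ∀ q, q ≠ p → ![xa, xb, xc, xd] q = true := by
  decide +kernel

theorem isUniversal_of_test {ab ac ad bc bd cd : Option EdgeKind} {a b c d : Bool}
    (h : universalTest ab ac ad bc bd cd a b c d = true) :
    (mk6 ab ac ad bc bd cd).IsUniversal ![a, b, c, d] := by
  simp only [universalTest, Bool.and_eq_true, allKinds_eq_true, and_assoc, Bool.not_eq_true'] at h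
  obtain ⟨h1, h2, h3, h4, h5, h6, h⟩ := h
  have hx : ∀ t, (∀ p, (mk6 ab ac ad bc bd cd).Excludes t p ↔
      ![clash ab (t 1) || clash ac (t 2) || clash ad (t 3),
        clash ab (t 0) || clash bc (t 2) || clash bd (t 3),
        clash ac (t 0) || clash bc (t 1) || clash cd (t 3),
        clash ad (t 0) || clash bd (t 1) || clash cd (t 2)] p = true) := by
    intro t p
    fin_cases p <;> simp [Excludes, mk6, Fin.exists_fin_succ, clash_eq_true, or_assoc]
  constructor
  · intro p q hp hq
    fin_cases p <;> fin_cases q <;> simp_all [mk6, isEdge_eq_false]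
  · intro t ht
    have h := h (t 0) (t 1) (t 2) (t 3)
    simp only [hx] at ht ⊢
    exact exists_label_of_hits _ _ _ _ _ _ _ _ h ht

-- The finite check: for each of the 729 model graphs, one of the 16 label sets is tested against
-- all 81 adjacency types, or a listing of the labels identifies the graph with an exceptional one.
-- All tests are plain Boolean functions, so that the kernel can evaluate them.
set_option maxRecDepth 10000 in
theorem universalTest_or_equivalentTest :
    (allKinds fun ab => allKinds fun ac => allKinds fun ad => allKinds fun bc =>
      allKinds fun bd => allKinds fun cd =>
        (anyBool fun a => anyBool fun b => anyBool fun c => anyBool fun d =>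
          universalTest ab ac ad bc bd cd a b c d) ||
        equivalentTest (mk6 ab ac ad bc bd cd) twoK2 ||
        equivalentTest (mk6 ab ac ad bc bd cd) k2S2 ||
        equivalentTest (mk6 ab ac ad bc bd cd) (fullCycle none none) ||
        equivalentTest (mk6 ab ac ad bc bd cd) (fullCycle none (some .dotted)) ||
        equivalentTest (mk6 ab ac ad bc bd cd) (fullCycle (some .full) (some .dotted)) ||
        equivalentTest (mk6 ab ac ad bc bd cd) (fullCycle (some .dotted) (some .dotted))) =
      true := by
  decide +kernel

/-- Only the exceptional model graphs have no universal set of labels. -/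
theorem exists_isUniversal {H : ModelGraph} (h₁ : ¬ H.Equivalent twoK2)
    (h₂ : ¬ H.Equivalent k2S2) (h₃ : ¬ H.Equivalent (fullCycle none none))
    (h₄ : ¬ H.Equivalent (fullCycle none (some .dotted)))
    (h₅ : ¬ H.Equivalent (fullCycle (some .full) (some .dotted)))
    (h₆ : ¬ H.Equivalent (fullCycle (some .dotted) (some .dotted))) :
    ∃ S, H.IsUniversal S := by
  have h := universalTest_or_equivalentTest
  simp only [allKinds_eq_true] at h
  have h := h (H.edge 0 1) (H.edge 0 2) (H.edge 0 3) (H.edge 1 2) (H.edge 1 3) (H.edge 2 3)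
  simp only [Bool.or_eq_true, anyBool_eq_true, ← eq_mk6] at h
  rcases h with (((((⟨a, b, c, d, h⟩ | h) | h) | h) | h) | h) | h
  · exact ⟨_, (congrArg (IsUniversal · _) H.eq_mk6).mpr (isUniversal_of_test h)⟩
  all_goals exact absurd (equivalent_of_test h) ‹_›

end ModelGraph

/-! ## From a closed propagation to a partition -/

namespace ModelGraph

variable {V : Type}

/-- `x` cannot have the label `p` because `y` has the label `q`. -/
def Conflict (H : ModelGraph) (G : SimpleGraph V) (x : V) (p : Fin 4) (y : V) (q : Fin 4) : Prop :=
  (H.edge p q = some .full ∧ ¬ G.Adj x y) ∨ (H.edge p q = some .dotted ∧ G.Adj x y)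

theorem Conflict.symm {H : ModelGraph} {G : SimpleGraph V} {x y : V} {p q : Fin 4}
    (h : H.Conflict G x p y q) : H.Conflict G y q x p := by
  rw [Conflict, H.symm, G.adj_comm]
  exact h

theorem isPartition_iff {H : ModelGraph} {G : SimpleGraph V} {f : V → Fin 4} :
    H.IsPartition G f ↔ f.Surjective ∧ ∀ x y, ¬ H.Conflict G x (f x) y (f y) := by
  refine and_congr_right fun _ => ⟨fun h x y => ?_, fun h => ⟨fun x y hxy => ?_, fun x y hxy => ?_⟩⟩
  · rintro (⟨h1, h2⟩ | ⟨h1, h2⟩)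
    exacts [h2 (h.1 x y h1), h.2 x y h1 h2]
  · by_contra h2
    exact h x y (Or.inl ⟨hxy, h2⟩)
  · exact fun h2 => h x y (Or.inr ⟨hxy, h2⟩)

/-- A propagation of labels `In` and impossible labels `Imp` from the base `u`. -/
structure Propagation (H : ModelGraph) (G : SimpleGraph V) (u : Fin 4 → V)
    (In Imp : V → Fin 4 → Prop) : Prop where
  inj : Function.Injective u
  base : ∀ p q, ¬ H.Conflict G (u p) p (u q) q
  in_iff : ∀ x p, In x p ↔ x = u p ∨ ∀ q, q ≠ p → Imp x q
  imp_iff : ∀ x p, Imp x p ↔ x ∉ Set.range u ∧ ∃ y q, In y q ∧ H.Conflict G x p y q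

namespace Propagation

variable {H : ModelGraph} {G : SimpleGraph V} {u : Fin 4 → V} {In Imp : V → Fin 4 → Prop}

/-- Base vertices have no impossible labels, so a base vertex never gets a second label by
propagation. A vertex with two propagated labels would have all four labels impossible. -/
theorem label_unique (h : H.Propagation G u In Imp) (hbad : ∀ x, ∃ p, ¬ Imp x p) {x : V}
    {p q : Fin 4} (hp : In x p) (hq : In x q) : p = q := by
  by_contra hpq
  have hbase : ∀ r, x = u r → ∀ s, ¬ Imp x s := fun r hr s hs =>
    ((h.imp_iff x s).1 hs).1 ⟨r, hr.symm⟩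
  rcases (h.in_iff x p).1 hp with hp | hp
  · rcases (h.in_iff x q).1 hq with hq | hq
    · exact hpq (h.inj (hp.symm.trans hq))
    · exact hbase p hp _ (hq p hpq)
  · rcases (h.in_iff x q).1 hq with hq | hq
    · exact hbase q hq _ (hp q (Ne.symm hpq))
    · obtain ⟨r, hr⟩ := hbad x
      by_cases hrp : r = p
      · exact hr (hq r (hrp ▸ hpq))
      · exact hr (hp r hrp)

/-- If all labels of `S` were impossible, universality applied to the adjacency type of `x` would
make three labels impossible, and propagation would decide `x`. -/
theorem exists_label_of_undecided (h : H.Propagation G u In Imp) {S : Fin 4 → Bool}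
    (hS : H.IsUniversal S) {x : V} (hx : ∀ p, ¬ In x p) : ∃ p, S p = true ∧ ¬ Imp x p := by
  classical
  by_contra! hcon
  have hxu : x ∉ Set.range u := by
    rintro ⟨p, rfl⟩
    exact hx p ((h.in_iff _ _).2 (Or.inl rfl))
  -- The adjacency type of `x` towards the labeled vertices; with it, impossibility becomes
  -- `Excludes`.
  let t : Fin 4 → Option EdgeKind := fun q =>
    if ∀ y, In y q → G.Adj x y then some .full
    else if ∀ y, In y q → ¬ G.Adj x y then some .dotted else none
  have ht : ∀ p, Imp x p ↔ H.Excludes t p := by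
    intro p
    rw [h.imp_iff]
    constructor
    · rintro ⟨-, y, q, hy, ⟨he, ha⟩ | ⟨he, ha⟩⟩ <;> refine ⟨q, by simp [he], ?_⟩
      · have : ¬ ∀ y, In y q → G.Adj x y := fun h => ha (h y hy)
        simp only [t, if_neg this, he]
        split_ifs <;> simp
      · have : ¬ ∀ y, In y q → ¬ G.Adj x y := fun h => h y hy ha
        simp only [t, if_neg this, he]
        split_ifs <;> simp
    · rintro ⟨q, hq, hqt⟩
      refine ⟨hxu, ?_⟩
      rcases he : H.edge p q with _ | _ | _
      · exact absurd he hq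
      · have : ¬ ∀ y, In y q → G.Adj x y := fun h => hqt (by simp only [he, t, if_pos h])
        push Not at this
        obtain ⟨y, hy, ha⟩ := this
        exact ⟨y, q, hy, Or.inl ⟨he, ha⟩⟩
      · by_cases h1 : ∀ y, In y q → G.Adj x y
        -- The class of `q` is nonempty because of the base, so being adjacent to all of it does
        -- contradict a dotted edge.
        · have hu : In (u q) q := (h.in_iff _ _).2 (Or.inl rfl)
          exact ⟨u q, q, hu, Or.inr ⟨he, h1 _ hu⟩⟩
        · have : ¬ ∀ y, In y q → ¬ G.Adj x y := fun h =>
            hqt (by simp only [he, t, if_neg h1, if_pos h])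
          push Not at this
          obtain ⟨y, hy, ha⟩ := this
          exact ⟨y, q, hy, Or.inr ⟨he, ha⟩⟩
  obtain ⟨p, hp⟩ := hS.2 t fun p hp => (ht p).1 (hcon p hp)
  exact hx p ((h.in_iff x p).2 (Or.inr fun q hq => (ht q).2 (hp q hq)))

/-- Labeled vertices keep their label and undecided ones take a possible label from `S`; every
conflict would then yield an impossible label, a conflict inside the base, or an edge of `H` inside
`S`. -/
theorem hPartition (h : H.Propagation G u In Imp) (hbad : ∀ x, ∃ p, ¬ Imp x p)
    {S : Fin 4 → Bool} (hS : H.IsUniversal S) : H.HPartition V G := by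
  have hf : ∀ x, ∃ p, ¬ Imp x p ∧ (In x p ∨ (∀ q, ¬ In x q) ∧ S p = true) := by
    intro x
    by_cases hx : ∃ p, In x p
    · obtain ⟨p, hp⟩ := hx
      refine ⟨p, fun hi => ?_, Or.inl hp⟩
      rcases (h.in_iff x p).1 hp with rfl | hq
      · exact ((h.imp_iff _ p).1 hi).1 ⟨p, rfl⟩
      · obtain ⟨q, hq'⟩ := hbad x
        by_cases hqp : q = p
        · exact hq' (hqp ▸ hi)
        · exact hq' (hq q hqp)
    · push Not at hx
      obtain ⟨p, hp, hp'⟩ := h.exists_label_of_undecided hS hx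
      exact ⟨p, hp', Or.inr ⟨hx, hp⟩⟩
  choose f hf1 hf2 using hf
  -- Uniqueness of labels makes `f` agree with the base, hence all four classes are nonempty.
  have hu : ∀ p, f (u p) = p := fun p => by
    have hup : In (u p) p := (h.in_iff _ _).2 (Or.inl rfl)
    rcases hf2 (u p) with hp | hp
    · exact h.label_unique hbad hp hup
    · exact absurd hup (hp.1 p)
  have key : ∀ x y, x ∉ Set.range u → In y (f y) → ¬ H.Conflict G x (f x) y (f y) :=
    fun x y hx hy hc => hf1 x ((h.imp_iff _ _).2 ⟨hx, y, _, hy, hc⟩)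
  have hrange : ∀ x, (∀ q, ¬ In x q) → x ∉ Set.range u := by
    rintro x hx ⟨p, rfl⟩
    exact hx p ((h.in_iff _ _).2 (Or.inl rfl))
  refine ⟨f, isPartition_iff.2 ⟨fun p => ⟨u p, hu p⟩, fun x y hc => ?_⟩⟩
  rcases hf2 x with hx | hx <;> rcases hf2 y with hy | hy
  · by_cases hxu : x ∈ Set.range u
    · by_cases hyu : y ∈ Set.range u
      · obtain ⟨p, rfl⟩ := hxu
        obtain ⟨q, rfl⟩ := hyu
        rw [hu, hu] at hc
        exact h.base p q hc
      · exact key y x hyu hx hc.symm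
    · exact key x y hxu hy hc
  · exact key y x (hrange y hy.1) hx hc.symm
  · exact key x y (hrange x hx.1) hy hc
  · have := hS.1 _ _ hx.2 hy.2
    simp [Conflict, this] at hc

end Propagation

end ModelGraph

/-! ## The rules of the general program -/

namespace GeneralProgram

open Datalog

/-- A fact about an intensional symbol. -/
abbrev fact (i : Sym) (v : Fin (arity i) → ℕ) : Fact arity := ⟨.idb i, v⟩

/-- The fact `vert(x)`. -/
abbrev vertFact (x : ℕ) : Fact arity := ⟨.vert, ![x]⟩

/-- The fact `e(x, y)`. -/
abbrev edgeFact (x y : ℕ) : Fact arity := ⟨.edge, ![x, y]⟩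

/-- The arguments `x, p, b`. -/
abbrev args6 (x p : ℕ) (b : Fin 4 → ℕ) : Fin 6 → ℕ := ![x, p, b 0, b 1, b 2, b 3]

/-- The arguments `x, b`. -/
abbrev args5 (x : ℕ) (b : Fin 4 → ℕ) : Fin 5 → ℕ := ![x, b 0, b 1, b 2, b 3]

/-! ### Ground instances of the atoms. -/

section ground

variable (s : ℕ → ℕ) (x p : Term)

/-- The values of the base variables. -/
abbrev baseVal : Fin 4 → ℕ := fun p => s p

@[simp]
theorem ground_vert : (vert x).ground s = vertFact (x.eval s) :=
  fact_ext (R := .vert) fun n : Fin 1 => by fin_cases n; rfl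

@[simp]
theorem ground_e : (e x p).ground s = edgeFact (x.eval s) (p.eval s) :=
  fact_ext (R := .edge) fun n : Fin 2 => by fin_cases n <;> rfl

@[simp]
theorem ground_full : (full x p).ground s = fact .full ![x.eval s, p.eval s] :=
  fact_ext (R := .idb Sym.full) fun n : Fin 2 => by fin_cases n <;> rfl

@[simp]
theorem ground_dotted : (dotted x p).ground s = fact .dotted ![x.eval s, p.eval s] :=
  fact_ext (R := .idb Sym.dotted) fun n : Fin 2 => by fin_cases n <;> rfl

@[simp]
theorem ground_eq : (eq x p).ground s = fact .eq ![x.eval s, p.eval s] :=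
  fact_ext (R := .idb Sym.eq) fun n : Fin 2 => by fin_cases n <;> rfl

@[simp]
theorem ground_distinct : distinct.ground s = fact .distinct (baseVal s) :=
  fact_ext (R := .idb Sym.distinct) fun n : Fin 4 => by fin_cases n <;> rfl

@[simp]
theorem ground_problematicBase :
    problematicBase.ground s = fact .problematicBase (baseVal s) :=
  fact_ext (R := .idb Sym.problematicBase) fun n : Fin 4 => by fin_cases n <;> rfl

@[simp]
theorem ground_base : base.ground s = fact .base (baseVal s) :=
  fact_ext (R := .idb Sym.base) fun n : Fin 4 => by fin_cases n <;> rfl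

@[simp]
theorem ground_badInit : badInit.ground s = fact .badInit (baseVal s) :=
  fact_ext (R := .idb Sym.badInit) fun n : Fin 4 => by fin_cases n <;> rfl

@[simp]
theorem ground_inPart :
    (inPart x p).ground s = fact .inPart (args6 (x.eval s) (p.eval s) (baseVal s)) :=
  fact_ext (R := .idb Sym.inPart) fun n : Fin 6 => by fin_cases n <;> rfl

@[simp]
theorem ground_imp :
    (imp x p).ground s = fact .imp (args6 (x.eval s) (p.eval s) (baseVal s)) :=
  fact_ext (R := .idb Sym.imp) fun n : Fin 6 => by fin_cases n <;> rfl

@[simp]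
theorem ground_fullProb :
    (fullProb x p).ground s = fact .fullProb (args6 (x.eval s) (p.eval s) (baseVal s)) :=
  fact_ext (R := .idb Sym.fullProb) fun n : Fin 6 => by fin_cases n <;> rfl

@[simp]
theorem ground_dotProb :
    (dotProb x p).ground s = fact .dotProb (args6 (x.eval s) (p.eval s) (baseVal s)) :=
  fact_ext (R := .idb Sym.dotProb) fun n : Fin 6 => by fin_cases n <;> rfl

@[simp]
theorem ground_done : (done x).ground s = fact .done (args5 (x.eval s) (baseVal s)) :=
  fact_ext (R := .idb Sym.done) fun n : Fin 5 => by fin_cases n <;> rfl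

@[simp]
theorem ground_yesInstance : yesInstance.ground s = fact .yesInstance ![] :=
  fact_ext (R := .idb Sym.yesInstance) fun n : Fin 0 => n.elim0

end ground

/-- The set `C` contains all heads of instances of rules whose positive atoms are in `N` and whose
negated atoms are not in `M`. -/
structure Consequences (H : ModelGraph) (N M C : Set (Fact arity)) : Prop where
  full : ∀ p q, H.edge p q = some .full → fact .full ![(p : ℕ), (q : ℕ)] ∈ C
  dotted : ∀ p q, H.edge p q = some .dotted → fact .dotted ![(p : ℕ), (q : ℕ)] ∈ C
  eq : ∀ x, vertFact x ∈ N → fact .eq ![x, x] ∈ C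
  distinct : ∀ b : Fin 4 → ℕ, (∀ p, vertFact (b p) ∈ N) →
    (∀ p q, p < q → fact .eq ![b p, b q] ∉ M) → fact .distinct b ∈ C
  base : ∀ b : Fin 4 → ℕ, fact .distinct b ∈ N → fact .problematicBase b ∉ M → fact .base b ∈ C
  problematic_dotted : ∀ (b : Fin 4 → ℕ) (p q : Fin 4), p < q →
    fact .dotted ![(p : ℕ), (q : ℕ)] ∈ N → edgeFact (b p) (b q) ∈ N →
    (∀ r, vertFact (b r) ∈ N) → fact .problematicBase b ∈ C
  problematic_full : ∀ (b : Fin 4 → ℕ) (p q : Fin 4), p < q →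
    fact .full ![(p : ℕ), (q : ℕ)] ∈ N → edgeFact (b p) (b q) ∉ M →
    (∀ r, vertFact (b r) ∈ N) → fact .problematicBase b ∈ C
  inPart_base : ∀ (b : Fin 4 → ℕ) (p : Fin 4), fact .base b ∈ N →
    fact .inPart (args6 (b p) p b) ∈ C
  done : ∀ (b : Fin 4 → ℕ) (p : Fin 4), fact .base b ∈ N → fact .done (args5 (b p) b) ∈ C
  imp_full : ∀ (b : Fin 4 → ℕ) (x p : ℕ), vertFact x ∈ N → fact .fullProb (args6 x p b) ∈ N →
    fact .done (args5 x b) ∉ M → fact .imp (args6 x p b) ∈ C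
  fullProb : ∀ (b : Fin 4 → ℕ) (x p y q : ℕ), fact .full ![p, q] ∈ N →
    fact .inPart (args6 y q b) ∈ N → vertFact x ∈ N → edgeFact x y ∉ M →
    fact .fullProb (args6 x p b) ∈ C
  imp_dotted : ∀ (b : Fin 4 → ℕ) (x p : ℕ), vertFact x ∈ N → fact .dotProb (args6 x p b) ∈ N →
    fact .done (args5 x b) ∉ M → fact .imp (args6 x p b) ∈ C
  dotProb : ∀ (b : Fin 4 → ℕ) (x p y q : ℕ), fact .dotted ![p, q] ∈ N →
    fact .inPart (args6 y q b) ∈ N → edgeFact x y ∈ N → fact .dotProb (args6 x p b) ∈ C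
  inPart_imp : ∀ (b : Fin 4 → ℕ) (x : ℕ) (p : Fin 4),
    (∀ q, q ≠ p → fact .imp (args6 x (q : ℕ) b) ∈ N) → fact .inPart (args6 x p b) ∈ C
  badInit : ∀ (b : Fin 4 → ℕ) (x : ℕ), vertFact x ∈ N → fact .base b ∈ N →
    (∀ q : Fin 4, fact .imp (args6 x q b) ∈ N) → fact .badInit b ∈ C
  yesInstance : ∀ b : Fin 4 → ℕ, fact .base b ∈ N → fact .badInit b ∉ M →
    fact .yesInstance ![] ∈ C
  noInstance : fact .yesInstance ![] ∉ M → fact .noInstance ![] ∈ C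

theorem fact_noInstance (v : Fin 0 → ℕ) : fact .noInstance v = fact .noInstance ![] :=
  congrArg (fact .noInstance) (Subsingleton.elim (α := Fin 0 → ℕ) v ![])

/-- The valuation of the variables `I, J, K, L, X, Y, P, Q`. -/
def valuation (b : Fin 4 → ℕ) (x y p q : ℕ) (n : ℕ) : ℕ :=
  [b 0, b 1, b 2, b 3, x, y, p, q].getD n 0

@[simp]
theorem baseVal_valuation (b : Fin 4 → ℕ) (x y p q : ℕ) : baseVal (valuation b x y p q) = b := by
  funext n
  fin_cases n <;> rfl

theorem valuation_base (b : Fin 4 → ℕ) (x y p q : ℕ) (r : Fin 4) :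
    valuation b x y p q r = b r := by
  fin_cases r <;> rfl

@[simp]
theorem eval_bv (b : Fin 4 → ℕ) (x y p q : ℕ) (r : Fin 4) :
    (bv r).eval (valuation b x y p q) = b r := valuation_base b x y p q r

@[simp]
theorem eval_vX (b : Fin 4 → ℕ) (x y p q : ℕ) : vX.eval (valuation b x y p q) = x := rfl

@[simp]
theorem eval_vY (b : Fin 4 → ℕ) (x y p q : ℕ) : vY.eval (valuation b x y p q) = y := rfl

@[simp]
theorem eval_vP (b : Fin 4 → ℕ) (x y p q : ℕ) : vP.eval (valuation b x y p q) = p := rfl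

@[simp]
theorem eval_vQ (b : Fin 4 → ℕ) (x y p q : ℕ) : vQ.eval (valuation b x y p q) = q := rfl

@[simp]
theorem eval_lab (s : ℕ → ℕ) (p : Fin 4) : (lab p).eval s = p := rfl

theorem mem_labels (p : Fin 4) : p ∈ labels := by revert p; decide

theorem mem_modelFacts {H : ModelGraph} {r : Rule arity} :
    r ∈ modelFacts H ↔
      (∃ p q, H.edge p q = some .full ∧ r = ⟨.full, ![lab p, lab q], [], []⟩) ∨
      (∃ p q, H.edge p q = some .dotted ∧ r = ⟨.dotted, ![lab p, lab q], [], []⟩) := by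
  simp only [modelFacts, List.mem_flatMap, mem_labels, true_and, ← exists_or]
  refine exists_congr fun p => exists_congr fun q => ?_
  rcases H.edge p q with _ | _ | _ <;> simp

theorem mem_pairs {pq : Fin 4 × Fin 4} : pq ∈ pairs ↔ pq.1 < pq.2 := by revert pq; decide

theorem mem_baseRules {H : ModelGraph} {r : Rule arity} (h : r ∈ baseRules) : r ∈ program H := by
  simp [program, h]

theorem mem_initRules {H : ModelGraph} {r : Rule arity} (h : r ∈ initRules) : r ∈ program H := by
  simp [program, h]

/-- Translates the syntax of the rules into conditions on facts, once and for all. With `N = M = C`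
the model it expresses closure; with `C` a predicate to be proved and `N` the model, or the model
intersected with `C`, it is the step of an induction. -/
theorem consequences_iff {H : ModelGraph} {N M C : Set (Fact arity)} :
    (∀ r ∈ program H, ∀ s, (∀ a ∈ r.pos, a.ground s ∈ N) → (∀ a ∈ r.neg, a.ground s ∉ M) →
      r.head.ground s ∈ C) ↔ Consequences H N M C := by
  constructor
  · intro h
    constructor
    case full =>
      intro p q hpq
      have := h ⟨.full, ![lab p, lab q], [], []⟩ (by
        simp only [program, List.mem_append, mem_modelFacts]
        grind) (fun _ => 0) (by simp) (by simp)
      exact ground_full _ (lab p) (lab q) ▸ this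
    case dotted =>
      intro p q hpq
      have := h ⟨.dotted, ![lab p, lab q], [], []⟩ (by
        simp only [program, List.mem_append, mem_modelFacts]
        grind) (fun _ => 0) (by simp) (by simp)
      exact ground_dotted _ (lab p) (lab q) ▸ this
    case eq =>
      intro x hx
      have : (eq vX vX).ground (valuation (fun _ => 0) x 0 0 0) ∈ C :=
        h ⟨.eq, ![vX, vX], [vert vX], []⟩
          (by simp [program, baseRules]) _
          (by simpa using hx) (by simp)
      simpa using this
    case distinct =>
      intro b hb hne
      have : distinct.ground (valuation b 0 0 0 0) ∈ C :=
        h ⟨.distinct, ![bv 0, bv 1, bv 2, bv 3], baseVerts,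
            pairs.map fun pq => eq (bv pq.1) (bv pq.2)⟩
          (by simp [program, baseRules]) _
          (by simpa [baseVerts, mem_labels] using hb)
            (List.forall_mem_map.2 fun pq h => by simpa using hne _ _ (mem_pairs.1 h))
      simpa using this
    case base =>
      intro b hd hp
      have : base.ground (valuation b 0 0 0 0) ∈ C :=
        h ⟨.base, ![bv 0, bv 1, bv 2, bv 3], [distinct], [problematicBase]⟩
          (by simp [program, baseRules]) _
          (by simpa using hd) (by simpa using hp)
      simpa using this
    case problematic_dotted =>
      intro b p q hpq hd he hv
      have : problematicBase.ground (valuation b 0 0 0 0) ∈ C :=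
        h ⟨.problematicBase, ![bv 0, bv 1, bv 2, bv 3],
            [dotted (lab p) (lab q), e (bv p) (bv q)] ++ baseVerts, []⟩
          (mem_baseRules (List.mem_append_right _ (List.mem_flatMap.2 ⟨(p, q), mem_pairs.2 hpq,
            by simp⟩))) _
          (by simpa [baseVerts, mem_labels] using ⟨hd, he, hv⟩) (by simp)
      simpa using this
    case problematic_full =>
      intro b p q hpq hd he hv
      have : problematicBase.ground (valuation b 0 0 0 0) ∈ C :=
        h ⟨.problematicBase, ![bv 0, bv 1, bv 2, bv 3],
            [full (lab p) (lab q)] ++ baseVerts, [e (bv p) (bv q)]⟩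
          (mem_baseRules (List.mem_append_right _ (List.mem_flatMap.2 ⟨(p, q), mem_pairs.2 hpq,
            by simp⟩))) _
          (by simpa [baseVerts, mem_labels] using ⟨hd, hv⟩) (by simpa using he)
      simpa using this
    case inPart_base =>
      intro b p hb
      have : (inPart (bv p) (lab p)).ground (valuation b 0 0 0 0) ∈ C :=
        h ⟨.inPart, ![bv p, lab p, bv 0, bv 1, bv 2, bv 3], [base], []⟩
          (mem_initRules (List.mem_flatMap.2 ⟨p, mem_labels p, by simp⟩)) _
          (by simpa using hb) (by simp)
      simpa using this
    case done =>
      intro b p hb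
      have : (done (bv p)).ground (valuation b 0 0 0 0) ∈ C :=
        h ⟨.done, ![bv p, bv 0, bv 1, bv 2, bv 3], [base], []⟩
          (mem_initRules (List.mem_flatMap.2 ⟨p, mem_labels p, by simp⟩)) _
          (by simpa using hb) (by simp)
      simpa using this
    case imp_full =>
      intro b x p hx hp hd
      have : (imp vX vP).ground (valuation b x 0 p 0) ∈ C :=
        h ⟨.imp, ![vX, vP, bv 0, bv 1, bv 2, bv 3], [vert vX, fullProb vX vP], [done vX]⟩
          (by simp [program, impRules]) _
          (by simpa using ⟨hx, hp⟩) (by simpa using hd)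
      simpa using this
    case fullProb =>
      intro b x p y q hpq hy hx he
      have : (fullProb vX vP).ground (valuation b x y p q) ∈ C :=
        h ⟨.fullProb, ![vX, vP, bv 0, bv 1, bv 2, bv 3], [full vP vQ, inPart vY vQ, vert vX],
          [e vX vY]⟩
          (by simp [program, impRules]) _
          (by simpa using ⟨hpq, hy, hx⟩) (by simpa using he)
      simpa using this
    case imp_dotted =>
      intro b x p hx hp hd
      have : (imp vX vP).ground (valuation b x 0 p 0) ∈ C :=
        h ⟨.imp, ![vX, vP, bv 0, bv 1, bv 2, bv 3], [vert vX, dotProb vX vP], [done vX]⟩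
          (by simp [program, impRules]) _
          (by simpa using ⟨hx, hp⟩) (by simpa using hd)
      simpa using this
    case dotProb =>
      intro b x p y q hpq hy he
      have : (dotProb vX vP).ground (valuation b x y p q) ∈ C :=
        h ⟨.dotProb, ![vX, vP, bv 0, bv 1, bv 2, bv 3],
            [dotted vP vQ, inPart vY vQ, e vX vY], []⟩
          (by simp [program, impRules]) _
          (by simpa using ⟨hpq, hy, he⟩) (by simp)
      simpa using this
    case badInit =>
      intro b x hx hb hi
      have : badInit.ground (valuation b x 0 0 0) ∈ C :=
        h ⟨.badInit, ![bv 0, bv 1, bv 2, bv 3], [vert vX, base, imp vX (lab 0), imp vX (lab 1),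
          imp vX (lab 2), imp vX (lab 3)], []⟩
          (by simp [program, answerRules]) _
          (by simpa using ⟨hx, hb, hi 0, hi 1, hi 2, hi 3⟩) (by simp)
      simpa using this
    case yesInstance =>
      intro b hb hi
      have : yesInstance.ground (valuation b 0 0 0 0) ∈ C :=
        h ⟨.yesInstance, ![], [base], [badInit]⟩
          (by simp [program, answerRules]) _
          (by simpa using hb) (by simpa using hi)
      simpa using this
    case inPart_imp =>
      intro b x p hi
      have : (inPart vX (lab p)).ground (valuation b x 0 0 0) ∈ C := by
        fin_cases p
        · exact h ⟨.inPart, ![vX, lab 0, bv 0, bv 1, bv 2, bv 3],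
              [imp vX (lab 1), imp vX (lab 2), imp vX (lab 3)], []⟩
            (by simp [program, propagationRules]) _
            (by simpa using ⟨hi 1 (by decide), hi 2 (by decide), hi 3 (by decide)⟩) (by simp)
        · exact h ⟨.inPart, ![vX, lab 1, bv 0, bv 1, bv 2, bv 3],
              [imp vX (lab 0), imp vX (lab 2), imp vX (lab 3)], []⟩
            (by simp [program, propagationRules]) _
            (by simpa using ⟨hi 0 (by decide), hi 2 (by decide), hi 3 (by decide)⟩) (by simp)
        · exact h ⟨.inPart, ![vX, lab 2, bv 0, bv 1, bv 2, bv 3],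
              [imp vX (lab 0), imp vX (lab 1), imp vX (lab 3)], []⟩
            (by simp [program, propagationRules]) _
            (by simpa using ⟨hi 0 (by decide), hi 1 (by decide), hi 3 (by decide)⟩) (by simp)
        · exact h ⟨.inPart, ![vX, lab 3, bv 0, bv 1, bv 2, bv 3],
              [imp vX (lab 0), imp vX (lab 1), imp vX (lab 2)], []⟩
            (by simp [program, propagationRules]) _
            (by simpa using ⟨hi 0 (by decide), hi 1 (by decide), hi 2 (by decide)⟩) (by simp)
      simpa using this
    case noInstance =>
      intro hy
      have := h ⟨.noInstance, ![], [], [yesInstance]⟩ (by simp [program, answerRules])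
        (fun _ => 0) (by simp) (by simpa using hy)
      rw [← fact_noInstance]
      exact this
  · intro h r hr s hpos hneg
    simp only [program, List.mem_append, mem_modelFacts, or_assoc] at hr
    rcases hr with ⟨p, q, hpq, rfl⟩ | ⟨p, q, hpq, rfl⟩ | hr | hr | hr | hr | hr
    · exact ground_full s (lab p) (lab q) ▸ h.full p q hpq
    · exact ground_dotted s (lab p) (lab q) ▸ h.dotted p q hpq
    · simp only [baseRules, List.mem_append, List.mem_cons, List.not_mem_nil, or_false,
        List.mem_flatMap, or_assoc] at hr
      rcases hr with rfl | rfl | rfl | ⟨pq, hpq, rfl | rfl⟩ <;>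
      simp only [List.forall_mem_cons, List.forall_mem_append, baseVerts, List.forall_mem_map,
        ground_vert, ground_eq, ground_distinct, ground_problematicBase, ground_dotted,
        ground_full, ground_e, mem_labels, mem_pairs, forall_true_left] at hpos hneg
      · exact ground_eq s vX vX ▸ h.eq _ hpos.1
      · exact ground_distinct s ▸ h.distinct _ hpos fun p q hpq => hneg (p, q) hpq
      · exact ground_base s ▸ h.base _ hpos.1 hneg.1
      · exact ground_problematicBase s ▸
          h.problematic_dotted _ _ _ (mem_pairs.1 hpq) hpos.1.1 hpos.1.2.1 hpos.2
      · exact ground_problematicBase s ▸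
          h.problematic_full _ _ _ (mem_pairs.1 hpq) hpos.1.1 hneg.1 hpos.2
    · simp only [initRules, List.mem_flatMap, List.mem_cons, List.not_mem_nil, or_false] at hr
      obtain ⟨p, -, rfl | rfl⟩ := hr <;>
      simp only [List.forall_mem_cons, ground_base] at hpos hneg
      · exact ground_inPart s (bv p) (lab p) ▸ h.inPart_base _ p hpos.1
      · exact ground_done s (bv p) ▸ h.done _ p hpos.1
    · simp only [impRules, List.mem_cons, List.not_mem_nil, or_false] at hr
      rcases hr with rfl | rfl | rfl | rfl <;>
      simp only [List.forall_mem_cons, ground_vert, ground_fullProb, ground_dotProb, ground_done,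
        ground_full, ground_dotted, ground_inPart, ground_e] at hpos hneg
      · exact ground_imp s vX vP ▸ h.imp_full _ _ _ hpos.1 hpos.2.1 hneg.1
      · exact ground_fullProb s vX vP ▸ h.fullProb _ _ _ _ _ hpos.1 hpos.2.1 hpos.2.2.1 hneg.1
      · exact ground_imp s vX vP ▸ h.imp_dotted _ _ _ hpos.1 hpos.2.1 hneg.1
      · exact ground_dotProb s vX vP ▸ h.dotProb _ _ _ _ _ hpos.1 hpos.2.1 hpos.2.2.1
    · simp only [propagationRules, List.mem_cons, List.not_mem_nil, or_false] at hr
      rcases hr with rfl | rfl | rfl | rfl <;>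
      simp only [List.forall_mem_cons, ground_imp] at hpos
      · refine ground_inPart s vX (lab 0) ▸ h.inPart_imp _ _ 0 fun q hq => ?_
        fin_cases q
        exacts [absurd rfl hq, hpos.1, hpos.2.1, hpos.2.2.1]
      · refine ground_inPart s vX (lab 1) ▸ h.inPart_imp _ _ 1 fun q hq => ?_
        fin_cases q
        exacts [hpos.1, absurd rfl hq, hpos.2.1, hpos.2.2.1]
      · refine ground_inPart s vX (lab 2) ▸ h.inPart_imp _ _ 2 fun q hq => ?_
        fin_cases q
        exacts [hpos.1, hpos.2.1, absurd rfl hq, hpos.2.2.1]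
      · refine ground_inPart s vX (lab 3) ▸ h.inPart_imp _ _ 3 fun q hq => ?_
        fin_cases q
        exacts [hpos.1, hpos.2.1, hpos.2.2.1, absurd rfl hq]
    · simp only [answerRules, List.mem_cons, List.not_mem_nil, or_false] at hr
      rcases hr with rfl | rfl | rfl <;>
      simp only [List.forall_mem_cons, ground_imp, ground_base, ground_badInit, ground_vert,
        ground_yesInstance] at hpos hneg
      · refine ground_badInit s ▸ h.badInit _ _ hpos.1 hpos.2.1 fun q => ?_
        fin_cases q
        exacts [hpos.2.2.1, hpos.2.2.2.1, hpos.2.2.2.2.1, hpos.2.2.2.2.2.1]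
      · exact ground_yesInstance s ▸ h.yesInstance _ hpos.1 hneg.1
      · exact (congrArg (· ∈ C) (fact_noInstance _)).mpr (h.noInstance hneg.1)

end GeneralProgram

/-! ## Safety and stratification of the general program -/

namespace GeneralProgram

open Datalog

/-- A stratification of the general program. -/
def level : Sym → ℕ
  | .full | .dotted | .eq | .problematicBase => 0
  | .distinct => 1
  | .base | .done => 2
  | .inPart | .imp | .fullProb | .dotProb | .badInit => 3
  | .yesInstance => 4
  | .noInstance => 5

theorem isStratification (H : ModelGraph) : IsStratification (program H) level := by
  intro r hr
  simp only [program, List.mem_append, mem_modelFacts, or_assoc, baseRules, initRules, impRules,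
    propagationRules, answerRules, List.mem_flatMap, List.mem_cons, List.not_mem_nil,
    or_false] at hr
  rcases hr with ⟨p, q, -, rfl⟩ | ⟨p, q, -, rfl⟩ | rfl | rfl | rfl | ⟨pq, -, rfl | rfl⟩ |
    ⟨p, -, rfl | rfl⟩ | rfl | rfl | rfl | rfl | rfl | rfl | rfl | rfl | rfl | rfl | rfl
  -- The rule for `distinct`, whose negated atoms form a mapped list.
  case inr.inr.inr.inl =>
    refine ⟨by simp [baseVerts, vert], List.forall_mem_map.2 fun pq _ i hi => ?_⟩
    cases hi
    decide
  all_goals simp [baseVerts, vert, e, full, dotted, distinct, problematicBase, base, inPart, done, imp,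
    fullProb, dotProb, badInit, yesInstance, level]

/-! ### Variables occurring in the atoms. -/

section hasVar

variable {x p : Term} {z : ℕ}

theorem bv_eq_var {p : Fin 4} : bv p = .var z ↔ (p : ℕ) = z := by simp [bv]

theorem hasVar_vert : (vert x).HasVar z ↔ x = .var z := by
  change (∃ n : Fin 1, _) ↔ _
  simp [vert]

theorem hasVar_e : (e x p).HasVar z ↔ x = .var z ∨ p = .var z := by
  change (∃ n : Fin 2, (![x, p] : Fin 2 → Term) n = _) ↔ _
  simp

theorem hasVar_eq : (eq x p).HasVar z ↔ x = .var z ∨ p = .var z := by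
  change (∃ n : Fin 2, (![x, p] : Fin 2 → Term) n = _) ↔ _
  simp

theorem hasVar_full : (full x p).HasVar z ↔ x = .var z ∨ p = .var z := by
  change (∃ n : Fin 2, (![x, p] : Fin 2 → Term) n = _) ↔ _
  simp

theorem hasVar_dotted : (dotted x p).HasVar z ↔ x = .var z ∨ p = .var z := by
  change (∃ n : Fin 2, (![x, p] : Fin 2 → Term) n = _) ↔ _
  simp

theorem exists_bv_eq_var : (∃ n, ![bv 0, bv 1, bv 2, bv 3] n = .var z) ↔ z < 4 := by
  simp only [Fin.exists_fin_succ, bv]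
  simp
  omega

theorem hasVar_distinct : distinct.HasVar z ↔ z < 4 := exists_bv_eq_var

theorem hasVar_problematicBase : problematicBase.HasVar z ↔ z < 4 := exists_bv_eq_var

theorem hasVar_base : base.HasVar z ↔ z < 4 := exists_bv_eq_var

theorem hasVar_badInit : badInit.HasVar z ↔ z < 4 := exists_bv_eq_var

theorem exists_six_eq_var :
    (∃ n, ![x, p, bv 0, bv 1, bv 2, bv 3] n = .var z) ↔ x = .var z ∨ p = .var z ∨ z < 4 := by
  rw [← exists_bv_eq_var, Fin.exists_fin_succ, Fin.exists_fin_succ]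
  rfl

theorem hasVar_inPart : (inPart x p).HasVar z ↔ x = .var z ∨ p = .var z ∨ z < 4 :=
  exists_six_eq_var

theorem hasVar_imp : (imp x p).HasVar z ↔ x = .var z ∨ p = .var z ∨ z < 4 :=
  exists_six_eq_var

theorem hasVar_fullProb : (fullProb x p).HasVar z ↔ x = .var z ∨ p = .var z ∨ z < 4 :=
  exists_six_eq_var

theorem hasVar_dotProb : (dotProb x p).HasVar z ↔ x = .var z ∨ p = .var z ∨ z < 4 :=
  exists_six_eq_var

theorem hasVar_done : (done x).HasVar z ↔ x = .var z ∨ z < 4 := by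
  rw [← exists_bv_eq_var]
  exact Fin.exists_fin_succ

theorem not_hasVar_yesInstance : ¬ yesInstance.HasVar z := fun ⟨n, _⟩ => Fin.elim0 n

end hasVar

theorem safe (H : ModelGraph) : ∀ r ∈ program H, r.Safe := by
  intro r hr
  have hbv : ∀ z < 4, ∃ a ∈ baseVerts, a.HasVar z := fun z hz =>
    ⟨_, List.mem_map_of_mem (mem_labels ⟨z, hz⟩), hasVar_vert.2 rfl⟩
  have hbv2 : ∀ (z : ℕ) (p : Fin 4), bv p = .var z → z < 4 := fun z p h => by
    rw [bv_eq_var] at h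
    omega
  have hlab : ∀ (z : ℕ) (p : Fin 4), ¬ lab p = .var z := fun z p h => by cases h
  -- Rewriting the head of a rule as a named atom makes the `hasVar` lemmas applicable to it.
  have heads : ∀ (r : Rule arity) (a : Atom arity), r.head = a →
      (∀ z, (a.HasVar z ∨ ∃ b ∈ r.neg, b.HasVar z) → ∃ b ∈ r.pos, b.HasVar z) → r.Safe :=
    fun r a ha h => by subst ha; exact h
  simp only [program, List.mem_append, mem_modelFacts, or_assoc, baseRules, initRules, impRules,
    propagationRules, answerRules, List.mem_flatMap, List.mem_cons, List.not_mem_nil,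
    or_false] at hr
  rcases hr with ⟨p, q, -, rfl⟩ | ⟨p, q, -, rfl⟩ | rfl | rfl | rfl | ⟨pq, -, rfl | rfl⟩ |
    ⟨p, -, rfl | rfl⟩ | rfl | rfl | rfl | rfl | rfl | rfl | rfl | rfl | rfl | rfl | rfl
  · refine heads _ (full (lab p) (lab q)) rfl ?_
    simp [hasVar_full, hlab]
  · refine heads _ (dotted (lab p) (lab q)) rfl ?_
    simp [hasVar_dotted, hlab]
  · refine heads _ (eq vX vX) rfl ?_
    simp [hasVar_eq, hasVar_vert]
  · refine heads _ distinct rfl ?_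
    simp only [hasVar_distinct, List.mem_map, Prod.exists]
    rintro z (hz | ⟨_, ⟨p, q, -, rfl⟩, hz⟩)
    · exact hbv z hz
    · exact hbv z ((hasVar_eq.1 hz).elim (hbv2 z p) (hbv2 z q))
  · refine heads _ base rfl ?_
    simp [hasVar_base, hasVar_distinct, hasVar_problematicBase]
  · refine heads _ problematicBase rfl ?_
    simp only [hasVar_problematicBase, List.not_mem_nil, false_and, exists_false, or_false,
      List.mem_append]
    exact fun z hz => (hbv z hz).imp fun a ha => ⟨Or.inr ha.1, ha.2⟩
  · refine heads _ problematicBase rfl ?_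
    simp only [hasVar_problematicBase, List.mem_singleton, exists_eq_left, hasVar_e,
      List.mem_append]
    exact fun z hz => (hbv z (hz.elim id fun h => h.elim (hbv2 z _) (hbv2 z _))).imp
      fun a ha => ⟨Or.inr ha.1, ha.2⟩
  · refine heads _ (inPart (bv p) (lab p)) rfl ?_
    simpa [hasVar_inPart, hasVar_base, hlab] using fun z hz => hz.elim (hbv2 z p) id
  · refine heads _ (done (bv p)) rfl ?_
    simpa [hasVar_done, hasVar_base] using fun z hz => hz.elim (hbv2 z p) id
  · refine heads _ (imp vX vP) rfl ?_
    simp [hasVar_imp, hasVar_vert, hasVar_fullProb, hasVar_done]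
    grind
  · refine heads _ (fullProb vX vP) rfl ?_
    simp [hasVar_full, hasVar_vert, hasVar_fullProb, hasVar_inPart, hasVar_e]
    grind
  · refine heads _ (imp vX vP) rfl ?_
    simp [hasVar_imp, hasVar_vert, hasVar_dotProb, hasVar_done]
    grind
  · refine heads _ (dotProb vX vP) rfl ?_
    simp [hasVar_dotted, hasVar_dotProb, hasVar_inPart, hasVar_e]
    grind
  · refine heads _ (inPart vX (lab 0)) rfl ?_
    simp [hasVar_inPart, hasVar_imp, hlab]
  · refine heads _ (inPart vX (lab 1)) rfl ?_
    simp [hasVar_inPart, hasVar_imp, hlab]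
  · refine heads _ (inPart vX (lab 2)) rfl ?_
    simp [hasVar_inPart, hasVar_imp, hlab]
  · refine heads _ (inPart vX (lab 3)) rfl ?_
    simp [hasVar_inPart, hasVar_imp, hlab]
  · refine heads _ badInit rfl ?_
    simp [hasVar_badInit, hasVar_base]
    grind
  · refine heads _ yesInstance rfl ?_
    simp [not_hasVar_yesInstance, hasVar_base, hasVar_badInit]
  · rintro z (⟨n, -⟩ | ⟨a, ha, hz⟩)
    · exact Fin.elim0 n
    · exact absurd (List.mem_singleton.1 ha ▸ hz) not_hasVar_yesInstance

end GeneralProgram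

/-! ## Semantics of the general program -/

namespace GeneralProgram

open Datalog

theorem args6_inj {x p x' p' : ℕ} {b b' : Fin 4 → ℕ} :
    args6 x p b = args6 x' p' b' ↔ x = x' ∧ p = p' ∧ b = b' := by
  refine ⟨fun h => ⟨congrFun h 0, congrFun h 1, funext fun n => ?_⟩, ?_⟩
  · fin_cases n
    exacts [congrFun h 2, congrFun h 3, congrFun h 4, congrFun h 5]
  · rintro ⟨rfl, rfl, rfl⟩
    rfl

theorem args5_inj {x x' : ℕ} {b b' : Fin 4 → ℕ} :
    args5 x b = args5 x' b' ↔ x = x' ∧ b = b' := by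
  refine ⟨fun h => ⟨congrFun h 0, funext fun n => ?_⟩, ?_⟩
  · fin_cases n
    exacts [congrFun h 1, congrFun h 2, congrFun h 3, congrFun h 4]
  · rintro ⟨rfl, rfl⟩
    rfl

/-- The fact is the head of an instance of a rule whose body holds in `M`. -/
def Supported (H : ModelGraph) (M : Set (Fact arity)) : Fact arity → Prop
  | ⟨.vert, _⟩ => True
  | ⟨.edge, _⟩ => True
  | ⟨.idb .full, v⟩ => ∃ p q : Fin 4, H.edge p q = some .full ∧ v = ![(p : ℕ), (q : ℕ)]
  | ⟨.idb .dotted, v⟩ => ∃ p q : Fin 4, H.edge p q = some .dotted ∧ v = ![(p : ℕ), (q : ℕ)]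
  | ⟨.idb .eq, v⟩ => ∃ x, v = ![x, x]
  | ⟨.idb .distinct, v⟩ =>
      (∀ p : Fin 4, vertFact (v p) ∈ M) ∧ ∀ p q : Fin 4, p < q → fact .eq ![v p, v q] ∉ M
  | ⟨.idb .problematicBase, v⟩ => ∃ p q : Fin 4,
      (fact .dotted ![(p : ℕ), (q : ℕ)] ∈ M ∧ edgeFact (v p) (v q) ∈ M) ∨
      (fact .full ![(p : ℕ), (q : ℕ)] ∈ M ∧ edgeFact (v p) (v q) ∉ M)
  | ⟨.idb .base, v⟩ => fact .distinct v ∈ M ∧ fact .problematicBase v ∉ M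
  | ⟨.idb .inPart, v⟩ =>
      (∃ (b : Fin 4 → ℕ) (p : Fin 4), fact .base b ∈ M ∧ v = args6 (b p) p b) ∨
      ∃ (b : Fin 4 → ℕ) (x : ℕ) (p : Fin 4),
        (∀ q, q ≠ p → fact .imp (args6 x (q : ℕ) b) ∈ M) ∧ v = args6 x p b
  | ⟨.idb .done, v⟩ => ∃ (b : Fin 4 → ℕ) (p : Fin 4), v = args5 (b p) b
  | ⟨.idb .imp, v⟩ => ∃ (b : Fin 4 → ℕ) (x p : ℕ), vertFact x ∈ M ∧
      (fact .fullProb (args6 x p b) ∈ M ∨ fact .dotProb (args6 x p b) ∈ M) ∧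
      fact .done (args5 x b) ∉ M ∧ v = args6 x p b
  | ⟨.idb .fullProb, v⟩ => ∃ (b : Fin 4 → ℕ) (x p y q : ℕ), fact .full ![p, q] ∈ M ∧
      fact .inPart (args6 y q b) ∈ M ∧ edgeFact x y ∉ M ∧ v = args6 x p b
  | ⟨.idb .dotProb, v⟩ => ∃ (b : Fin 4 → ℕ) (x p y q : ℕ), fact .dotted ![p, q] ∈ M ∧
      fact .inPart (args6 y q b) ∈ M ∧ edgeFact x y ∈ M ∧ v = args6 x p b
  | ⟨.idb .badInit, v⟩ => ∃ x, vertFact x ∈ M ∧ ∀ q : Fin 4, fact .imp (args6 x q v) ∈ M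
  | ⟨.idb .yesInstance, _⟩ => ∃ b, fact .base b ∈ M ∧ fact .badInit b ∉ M
  | ⟨.idb .noInstance, _⟩ => True

variable {H : ModelGraph} {V : Type} {G : SimpleGraph V} {name : V ↪ ℕ}

/-- `Supported` unfolds a fact by one rule only, so no induction hypothesis is involved and `M` can
be arbitrary. -/
theorem supported_consequences (H : ModelGraph) (M : Set (Fact arity)) :
    Consequences H M M {x | Supported H M x} where
  full p q h := ⟨p, q, h, rfl⟩
  dotted p q h := ⟨p, q, h, rfl⟩
  eq x _ := ⟨x, rfl⟩
  distinct _ h h' := ⟨h, h'⟩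
  base _ h h' := ⟨h, h'⟩
  problematic_dotted _ p q _ h h' _ := ⟨p, q, Or.inl ⟨h, h'⟩⟩
  problematic_full _ p q _ h h' _ := ⟨p, q, Or.inr ⟨h, h'⟩⟩
  inPart_base b p h := Or.inl ⟨b, p, h, rfl⟩
  done b p _ := ⟨b, p, rfl⟩
  imp_full b x p h h' h'' := ⟨b, x, p, h, Or.inl h', h'', rfl⟩
  fullProb b x p y q h h' _ h'' := ⟨b, x, p, y, q, h, h', h'', rfl⟩
  imp_dotted b x p h h' h'' := ⟨b, x, p, h, Or.inr h', h'', rfl⟩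
  dotProb b x p y q h h' h'' := ⟨b, x, p, y, q, h, h', h'', rfl⟩
  inPart_imp b x p h := Or.inr ⟨b, x, p, h, rfl⟩
  badInit _ x h _ h' := ⟨x, h, h'⟩
  yesInstance b h h' := ⟨b, h, h'⟩
  noInstance _ := trivial

/-- The model of the general program on a graph. -/
abbrev graphModel (H : ModelGraph) (G : SimpleGraph V) (name : V ↪ ℕ) : Set (Fact arity) :=
  model (program H) level (graphFacts arity G name)

theorem graphModel_subset {C : Set (Fact arity)} (hD : graphFacts arity G name ⊆ C)
    (hC : Consequences H (graphModel H G name ∩ C) (graphModel H G name) C) :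
    graphModel H G name ⊆ C := fun _ hx =>
  model_induction (Q := (· ∈ C)) (isStratification H) hD
    (consequences_iff.2 hC) hx

theorem consequences_graphModel :
    Consequences H (graphModel H G name) (graphModel H G name) (graphModel H G name) :=
  consequences_iff.1 fun _ hr s => head_mem_model (isStratification H) hr s

/-- Inversion: a derived fact must come from a rule whose body holds. Together with closure this
characterizes the symbols of the program. -/
theorem supported {x : Fact arity} (hx : x ∈ graphModel H G name) :
    Supported H (graphModel H G name) x := by
  refine model_induction (Q := Supported H (graphModel H G name)) (isStratification H) ?_
    (fun r hr s hpos hneg => consequences_iff.2 (supported_consequences H _) r hr s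
      (fun a ha => (hpos a ha).1) hneg) hx
  rintro x (⟨v, rfl⟩ | ⟨u, v, _, rfl⟩) <;> trivial

theorem edgeFact_mem {x y : V} : edgeFact (name x) (name y) ∈ graphModel H G name ↔ G.Adj x y := by
  refine edge_mem_model.trans ⟨?_, fun h => ⟨x, y, h, rfl, rfl⟩⟩
  rintro ⟨u, v, h, hu, hv⟩
  rwa [← name.injective hu, ← name.injective hv]

theorem vertFact_mem (x : V) : vertFact (name x) ∈ graphModel H G name :=
  vert_mem_model.2 ⟨x, rfl⟩

theorem pair_inj {x y x' y' : ℕ} (h : ![x, y] = ![x', y']) : x = x' ∧ y = y' :=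
  ⟨congrFun h 0, congrFun h 1⟩

theorem full_mem {x y : ℕ} : fact .full ![x, y] ∈ graphModel H G name ↔
    ∃ p q : Fin 4, H.edge p q = some .full ∧ x = p ∧ y = q := by
  constructor
  · intro h
    obtain ⟨p, q, hpq, h⟩ := supported h
    exact ⟨p, q, hpq, pair_inj h⟩
  · rintro ⟨p, q, hpq, rfl, rfl⟩
    exact consequences_graphModel.full p q hpq

theorem dotted_mem {x y : ℕ} : fact .dotted ![x, y] ∈ graphModel H G name ↔
    ∃ p q : Fin 4, H.edge p q = some .dotted ∧ x = p ∧ y = q := by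
  constructor
  · intro h
    obtain ⟨p, q, hpq, h⟩ := supported h
    exact ⟨p, q, hpq, pair_inj h⟩
  · rintro ⟨p, q, hpq, rfl, rfl⟩
    exact consequences_graphModel.dotted p q hpq

theorem full_mem_label {p q : Fin 4} :
    fact .full ![(p : ℕ), (q : ℕ)] ∈ graphModel H G name ↔ H.edge p q = some .full := by
  rw [full_mem]
  refine ⟨?_, fun h => ⟨p, q, h, rfl, rfl⟩⟩
  rintro ⟨p', q', h, hp, hq⟩
  rwa [Fin.ext hp, Fin.ext hq]

theorem dotted_mem_label {p q : Fin 4} :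
    fact .dotted ![(p : ℕ), (q : ℕ)] ∈ graphModel H G name ↔ H.edge p q = some .dotted := by
  rw [dotted_mem]
  refine ⟨?_, fun h => ⟨p, q, h, rfl, rfl⟩⟩
  rintro ⟨p', q', h, hp, hq⟩
  rwa [Fin.ext hp, Fin.ext hq]

/-- The rules inspect only pairs `p < q`; symmetry of `Conflict` and looplessness of `H` supply the
other pairs. -/
theorem base_mem {b : Fin 4 → ℕ} : fact .base b ∈ graphModel H G name ↔
    ∃ u : Fin 4 → V, (∀ p, b p = name (u p)) ∧ Function.Injective u ∧
      ∀ p q, ¬ H.Conflict G (u p) p (u q) q := by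
  constructor
  · intro h
    obtain ⟨hd, hp⟩ := supported h
    obtain ⟨hv, hne⟩ := supported hd
    choose u hu using fun p => vert_mem_model.1 (hv p)
    have hb : b = fun p => name (u p) := funext fun p => (hu p).symm
    subst hb
    have hlt : ∀ p q, p < q → ¬ H.Conflict G (u p) p (u q) q := by
      rintro p q hpq (⟨he, ha⟩ | ⟨he, ha⟩)
      · exact hp (consequences_graphModel.problematic_full _ p q hpq (full_mem_label.2 he)
          (fun h => ha (edgeFact_mem.1 h)) hv)
      · exact hp (consequences_graphModel.problematic_dotted _ p q hpq (dotted_mem_label.2 he)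
          (edgeFact_mem.2 ha) hv)
    have hlt' : ∀ p q, p < q → u p ≠ u q := fun p q hpq h => by
      refine hne p q hpq ?_
      change fact .eq ![name (u p), name (u q)] ∈ _
      rw [h]
      exact consequences_graphModel.eq _ (hv q)
    refine ⟨u, fun _ => rfl, fun p q h => ?_, fun p q h => ?_⟩
    · rcases lt_trichotomy p q with hpq | hpq | hpq
      exacts [absurd h (hlt' p q hpq), hpq, absurd h.symm (hlt' q p hpq)]
    · rcases lt_trichotomy p q with hpq | rfl | hpq
      · exact hlt p q hpq h
      · simp [ModelGraph.Conflict, H.loopless] at h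
      · exact hlt q p hpq h.symm
  · rintro ⟨u, hu, hinj, hc⟩
    obtain rfl : b = fun p => name (u p) := funext hu
    refine consequences_graphModel.base _ (consequences_graphModel.distinct _
      (fun p => vertFact_mem _) fun p q hpq h => ?_) fun h => ?_
    · obtain ⟨x, hx⟩ := supported h
      obtain ⟨h1, h2⟩ := pair_inj hx
      exact hpq.ne (hinj (name.injective (h1.trans h2.symm)))
    · obtain ⟨p, q, ⟨h1, h2⟩ | ⟨h1, h2⟩⟩ := supported h
      · exact hc p q (Or.inr ⟨dotted_mem_label.1 h1, edgeFact_mem.1 h2⟩)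
      · exact hc p q (Or.inl ⟨full_mem_label.1 h1, fun h => h2 (edgeFact_mem.2 h)⟩)

theorem done_mem {x : ℕ} {b : Fin 4 → ℕ} (hb : fact .base b ∈ graphModel H G name) :
    fact .done (args5 x b) ∈ graphModel H G name ↔ ∃ p, b p = x := by
  constructor
  · intro h
    obtain ⟨b', p, h⟩ := supported h
    obtain ⟨rfl, rfl⟩ := args5_inj.1 h
    exact ⟨p, rfl⟩
  · rintro ⟨p, rfl⟩
    exact consequences_graphModel.done b p hb

/-- The program propagates labels from every base. -/
theorem propagation {u : Fin 4 → V} (hinj : Function.Injective u)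
    (hc : ∀ p q, ¬ H.Conflict G (u p) p (u q) q) :
    H.Propagation G u
      (fun x p => fact .inPart (args6 (name x) p fun q => name (u q)) ∈ graphModel H G name)
      (fun x p => fact .imp (args6 (name x) p fun q => name (u q)) ∈ graphModel H G name) := by
  have hb : fact .base (fun q => name (u q)) ∈ graphModel H G name :=
    base_mem.2 ⟨u, fun _ => rfl, hinj, hc⟩
  have hdone : ∀ x, fact .done (args5 (name x) fun q => name (u q)) ∈ graphModel H G name ↔
      x ∈ Set.range u := fun x => (done_mem hb).trans <|
    exists_congr fun p => name.injective.eq_iff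
  refine ⟨hinj, hc, fun x p => ⟨fun h => ?_, ?_⟩, fun x p => ⟨fun h => ?_, ?_⟩⟩
  · rcases supported h with ⟨b, q, -, h⟩ | ⟨b, y, q, hq, h⟩
    · obtain ⟨h1, h2, rfl⟩ := args6_inj.1 h
      rw [Fin.ext h2]
      exact Or.inl (name.injective h1)
    · obtain ⟨rfl, h2, rfl⟩ := args6_inj.1 h
      rw [Fin.ext h2]
      exact Or.inr hq
  · rintro (rfl | h)
    · exact consequences_graphModel.inPart_base _ p hb
    · exact consequences_graphModel.inPart_imp _ _ p h
  · obtain ⟨b, y, q, -, hprob, hdn, h⟩ := supported h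
    obtain ⟨rfl, rfl, rfl⟩ := args6_inj.1 h
    refine ⟨fun hx => hdn ((hdone x).2 hx), ?_⟩
    -- Labeled constants do name vertices: either they belong to the base, or they come from an
    -- `imp` fact, whose rule requires `vert`.
    have hvert : ∀ (y : ℕ) (q : Fin 4),
        fact .inPart (args6 y q fun q => name (u q)) ∈ graphModel H G name →
          ∃ z, name z = y := by
      intro y q h
      rcases supported h with ⟨b, q', -, h⟩ | ⟨b, y', q', hq, h⟩
      · obtain ⟨rfl, -, rfl⟩ := args6_inj.1 h
        exact ⟨_, rfl⟩
      · obtain ⟨rfl, -, rfl⟩ := args6_inj.1 h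
        obtain ⟨r, hr⟩ := exists_ne q'
        obtain ⟨b, y', q', hy, -, -, h⟩ := supported (hq r hr)
        obtain ⟨rfl, -, -⟩ := args6_inj.1 h
        exact vert_mem_model.1 hy
    rcases hprob with h | h
    · obtain ⟨b, x', p', y, q, hpq, hy, hxy, h⟩ := supported h
      obtain ⟨rfl, rfl, rfl⟩ := args6_inj.1 h
      obtain ⟨p', q', he, hp, rfl⟩ := full_mem.1 hpq
      obtain ⟨z, rfl⟩ := hvert y q' hy
      rw [← Fin.ext hp] at he
      exact ⟨z, q', hy, Or.inl ⟨he, fun h => hxy (edgeFact_mem.2 h)⟩⟩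
    · obtain ⟨b, x', p', y, q, hpq, hy, hxy, h⟩ := supported h
      obtain ⟨rfl, rfl, rfl⟩ := args6_inj.1 h
      obtain ⟨p', q', he, hp, rfl⟩ := dotted_mem.1 hpq
      obtain ⟨z, rfl⟩ := hvert y q' hy
      rw [← Fin.ext hp] at he
      exact ⟨z, q', hy, Or.inr ⟨he, edgeFact_mem.1 hxy⟩⟩
  · rintro ⟨hx, y, q, hy, ⟨he, ha⟩ | ⟨he, ha⟩⟩
    · refine consequences_graphModel.imp_full _ _ _ (vertFact_mem x) ?_ fun h => hx ((hdone x).1 h)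
      exact consequences_graphModel.fullProb _ _ _ _ q (full_mem_label.2 he) hy (vertFact_mem x)
        fun h => ha (edgeFact_mem.1 h)
    · refine consequences_graphModel.imp_dotted _ _ _ (vertFact_mem x) ?_
        fun h => hx ((hdone x).1 h)
      exact consequences_graphModel.dotProb _ _ _ _ q (dotted_mem_label.2 he) hy
        (edgeFact_mem.2 ha)

/-- The fact, if it concerns the base `b`, is correct for the labeling `f`. -/
def Correct (f : V → Fin 4) (name : V ↪ ℕ) (b : Fin 4 → ℕ) : Fact arity → Prop
  | ⟨.idb .inPart, v⟩ => ∀ x p, v = args6 x p b → ∃ y, name y = x ∧ p = f y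
  | ⟨.idb .imp, v⟩ => ∀ x p, v = args6 x p b → ∃ y, name y = x ∧ p ≠ f y
  | ⟨.idb .fullProb, v⟩ => ∀ x p, v = args6 x p b → ∃ y, name y = x ∧ p ≠ f y
  | ⟨.idb .dotProb, v⟩ => ∀ x p, v = args6 x p b → ∃ y, name y = x ∧ p ≠ f y
  | _ => True

/-- With base vertices chosen from the classes of `f`, a label is ruled out only by a conflict with
a correctly labeled vertex, and `f` has no conflicts. Facts about other bases are left
unconstrained. -/
theorem correct_consequences {f : V → Fin 4} {u : Fin 4 → V} (hu : ∀ p, f (u p) = p)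
    (hf : ∀ x y, ¬ H.Conflict G x (f x) y (f y)) :
    Consequences H (graphModel H G name ∩ {x | Correct f name (fun q => name (u q)) x})
      (graphModel H G name) {x | Correct f name (fun q => name (u q)) x} where
  full _ _ _ := trivial
  dotted _ _ _ := trivial
  eq _ _ := trivial
  distinct _ _ _ := trivial
  base _ _ _ := trivial
  problematic_dotted _ _ _ _ _ _ _ := trivial
  problematic_full _ _ _ _ _ _ _ := trivial
  inPart_base b p _ x q h := by
    obtain ⟨rfl, rfl, rfl⟩ := args6_inj.1 h
    exact ⟨u p, rfl, by rw [hu]⟩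
  done _ _ _ := trivial
  imp_full b x p _ h _ := h.2
  imp_dotted b x p _ h _ := h.2
  fullProb b x p y q hpq hy hx hxy x' p' h := by
    obtain ⟨rfl, rfl, rfl⟩ := args6_inj.1 h
    obtain ⟨z, rfl, rfl⟩ := hy.2 y q rfl
    obtain ⟨w, rfl⟩ := vert_mem_model.1 hx.1
    refine ⟨w, rfl, ?_⟩
    rintro rfl
    exact hf w z (Or.inl ⟨full_mem_label.1 hpq.1, fun h => hxy (edgeFact_mem.2 h)⟩)
  dotProb b x p y q hpq hy hxy x' p' h := by
    obtain ⟨rfl, rfl, rfl⟩ := args6_inj.1 h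
    obtain ⟨z, rfl, rfl⟩ := hy.2 y q rfl
    obtain ⟨w, z', ha, rfl, hz⟩ := edge_mem_model.1 hxy.1
    obtain rfl := name.injective hz
    refine ⟨w, rfl, ?_⟩
    rintro rfl
    exact hf w z' (Or.inr ⟨dotted_mem_label.1 hpq.1, ha⟩)
  inPart_imp b x p hi x' p' h := by
    obtain ⟨rfl, rfl, rfl⟩ := args6_inj.1 h
    have hi' : ∀ q, q ≠ p → ∃ y, name y = x ∧ (q : ℕ) ≠ f y := fun q hq => (hi q hq).2 x q rfl
    obtain ⟨r, hr⟩ := exists_ne p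
    obtain ⟨y, rfl, -⟩ := hi' r hr
    refine ⟨y, rfl, ?_⟩
    -- Otherwise `f y` would be among the labels other than `p`, all of which are impossible.
    by_contra hne
    obtain ⟨z, hz, hzq⟩ := hi' (f y) fun h => hne (by rw [h])
    exact hzq (by rw [name.injective hz])
  badInit _ _ _ _ _ := trivial
  yesInstance _ _ _ := trivial
  noInstance _ := trivial

/-- The general program is correct for every model graph that has a universal set of labels. -/
theorem yesInstance_mem {S : Fin 4 → Bool} (hS : H.IsUniversal S) :
    fact .yesInstance ![] ∈ graphModel H G name ↔ H.HPartition V G := by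
  constructor
  · intro h
    obtain ⟨b, hb, hbad⟩ := supported h
    obtain ⟨u, hu, hinj, hc⟩ := base_mem.1 hb
    obtain rfl : b = fun p => name (u p) := funext hu
    refine (propagation (name := name) hinj hc).hPartition (fun x => ?_) hS
    by_contra! hx
    exact hbad (consequences_graphModel.badInit _ (name x) (vertFact_mem x) hb hx)
  · rintro ⟨f, hf⟩
    obtain ⟨hsurj, hf⟩ := ModelGraph.isPartition_iff.1 hf
    -- One representative of each class of `f` forms the base that witnesses the positive answer.
    choose u hu using hsurj
    have hinj : Function.Injective u := fun p q h => by rw [← hu p, ← hu q, h]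
    have hb : fact .base (fun q => name (u q)) ∈ graphModel H G name :=
      base_mem.2 ⟨u, fun _ => rfl, hinj, fun p q h => hf (u p) (u q) (by rwa [hu, hu])⟩
    refine consequences_graphModel.yesInstance _ hb fun h => ?_
    obtain ⟨x, hx, himp⟩ := supported h
    obtain ⟨y, rfl⟩ := vert_mem_model.1 hx
    have hcor := graphModel_subset (C := {x | Correct f name (fun q => name (u q)) x})
      (by rintro x (⟨v, rfl⟩ | ⟨u, v, _, rfl⟩) <;> trivial)
      (correct_consequences (G := G) hu hf) (himp (f y))
    obtain ⟨z, hz, hne⟩ := hcor (name y) (f y) rfl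
    exact hne (by rw [name.injective hz])

theorem stratifiedDecides {S : Fin 4 → Bool} (hS : H.IsUniversal S) :
    StratifiedDecides (program H) .yesInstance H.HPartition := by
  refine ⟨rfl, safe H, level, isStratification H, fun V _ G name => ?_⟩
  rw [← yesInstance_mem (name := name) hS]
  refine ⟨fun ⟨t, ht⟩ => ?_, fun h => ⟨_, h⟩⟩
  rwa [show t = ![] from Subsingleton.elim (α := Fin 0 → ℕ) _ _] at ht

end GeneralProgram

/-! ## Partitions into a join with a disconnected side -/

namespace ModelGraph

variable {V : Type} {G : SimpleGraph V}

/-- Connectivity in the complement. -/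
abbrev CoReach (G : SimpleGraph V) : V → V → Prop := Gᶜ.Reachable

/-- Connectivity inside the components of the complement. -/
def InReach (G : SimpleGraph V) : V → V → Prop :=
  Relation.ReflTransGen fun x y => G.Adj x y ∧ CoReach G x y

/-- The component of `x` in the complement induces a disconnected subgraph. -/
def Splits (G : SimpleGraph V) (x : V) : Prop := ∃ y, CoReach G x y ∧ ¬ InReach G x y

theorem InReach.coReach {x y : V} (h : InReach G x y) : CoReach G x y := by
  induction h with
  | refl => exact SimpleGraph.Reachable.refl _
  | tail _ h ih => exact ih.trans h.2

theorem adj_of_not_coReach {x y z : V} (hy : CoReach G x y) (hz : ¬ CoReach G x z) :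
    G.Adj y z := by
  by_contra h
  have hne : y ≠ z := fun h => hz (h ▸ hy)
  exact hz (hy.trans (SimpleGraph.Adj.reachable ((SimpleGraph.compl_adj _ _ _).2 ⟨hne, h⟩)))

theorem not_adj_of_not_inReach {x y z : V} (hy : InReach G x y) (hz : CoReach G x z)
    (hz' : ¬ InReach G x z) : ¬ G.Adj y z := fun h =>
  hz' (hy.tail ⟨h, hy.coReach.symm.trans hz⟩)

/-- A set that is complete to its outside is a union of components of the complement. -/
theorem coReach_closed {P : V → Prop} (hP : ∀ x y, P x → ¬ P y → G.Adj x y) {x y : V}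
    (h : CoReach G x y) (hx : P x) : P y := by
  rw [CoReach, SimpleGraph.reachable_iff_reflTransGen] at h
  induction h with
  | refl => exact hx
  | tail _ h ih =>
    by_contra hy
    exact ((SimpleGraph.compl_adj _ _ _).1 h).2 (hP _ _ ih hy)

/-- Two nonadjacent classes that are jointly complete to the other vertices form a component of
the complement. -/
theorem splits_of_classes {P Q : V → Prop} {x y : V} (hx : P x) (hy : Q y)
    (hPQ : ∀ u v, P u → Q v → u ≠ v ∧ ¬ G.Adj u v)
    (hout : ∀ u v, P u ∨ Q u → ¬ (P v ∨ Q v) → G.Adj u v) :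
    Splits G x ∧ ∀ z, CoReach G x z ↔ P z ∨ Q z := by
  have hadj : ∀ u v, P u → Q v → CoReach G u v := fun u v hu hv =>
    SimpleGraph.Adj.reachable ((SimpleGraph.compl_adj _ _ _).2 (hPQ u v hu hv))
  refine ⟨⟨y, hadj x y hx hy, fun h => ?_⟩, fun z => ⟨fun h => ?_, ?_⟩⟩
  -- A walk inside the complement component that starts in `P` never leaves `P`, because there are
  -- no edges between `P` and `Q`.
  · have hP : P y := by
      clear hy
      induction h with
      | refl => exact hx
      | tail _ h ih =>
        rcases coReach_closed hout h.2 (Or.inl ih) with hP | hQ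
        · exact hP
        · exact absurd h.1 (hPQ _ _ ih hQ).2
    exact (hPQ y y hP hy).1 rfl
  · exact coReach_closed hout h (Or.inl hx)
  · rintro (hz | hz)
    · exact (hadj x y hx hy).trans (hadj z y hz hy).symm
    · exact hadj x z hx hz

/-- The side of the join opposite to the component of `x` in the complement can be divided into
two classes of type `k`. -/
def RestDivides (G : SimpleGraph V) (x : V) : Option EdgeKind → Prop
  | none => ∃ y z, y ≠ z ∧ ¬ CoReach G x y ∧ ¬ CoReach G x z
  | some .full => ∃ y z, ¬ CoReach G y z ∧ ¬ CoReach G x y ∧ ¬ CoReach G x z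
  | some .dotted => ∃ y, Splits G y ∧ ¬ CoReach G x y ∧ ∀ z, CoReach G x z ∨ CoReach G y z

/-- Inside the complement component of `x`, the part reachable from `x` becomes `B` and the rest
becomes `D`. Outside it, `R` separates `A` from `C`. The edges of the cycle are present because
different complement components are completely joined. -/
theorem hPartition_of_splits {k : Option EdgeKind} {x y z : V} {R : V → Prop} (hx : Splits G x)
    (hy : ¬ CoReach G x y) (hyR : R y) (hz : ¬ CoReach G x z) (hzR : ¬ R z)
    (hk : ∀ u v, ¬ CoReach G x u → ¬ CoReach G x v → R u → ¬ R v →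
      (k = some .full → G.Adj u v) ∧ (k = some .dotted → ¬ G.Adj u v)) :
    (fullCycle k (some .dotted)).HPartition V G := by
  classical
  obtain ⟨w, hw, hw'⟩ := hx
  let f : V → Fin 4 := fun v =>
    if CoReach G x v then if InReach G x v then 1 else 3 else if R v then 0 else 2
  refine ⟨f, isPartition_iff.2 ⟨fun p => ?_, ?_⟩⟩
  · fin_cases p
    · exact ⟨y, by simp [f, hy, hyR]⟩
    · have h : InReach G x x := Relation.ReflTransGen.refl
      exact ⟨x, by simp [f, h]⟩
    · exact ⟨z, by simp [f, hz, hzR]⟩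
    · exact ⟨w, by simp [f, hw, hw']⟩
  -- Symmetry of `Conflict` and looplessness reduce everything to increasing pairs of labels.
  · have key : ∀ u v, f u < f v → ¬ (fullCycle k (some .dotted)).Conflict G u (f u) v (f v) := by
      intro u v
      by_cases hu : CoReach G x u <;> by_cases hv : CoReach G x v
      · by_cases hu' : InReach G x u <;> by_cases hv' : InReach G x v <;>
          simp [f, hu, hv, hu', hv', Conflict, fullCycle, mk6]
        exact not_adj_of_not_inReach hu' hv hv'
      · have := adj_of_not_coReach hu hv
        by_cases hu' : InReach G x u <;> by_cases hv' : R v <;>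
          simp [f, hu, hv, hu', hv', Conflict, fullCycle, mk6, this]
      · have := (adj_of_not_coReach hv hu).symm
        by_cases hu' : R u <;> by_cases hv' : InReach G x v <;>
          simp [f, hu, hv, hu', hv', Conflict, fullCycle, mk6, this]
      · by_cases hu' : R u <;> by_cases hv' : R v <;>
          simp [f, hu, hv, hu', hv', Conflict, fullCycle, mk6]
        exact hk u v hu hv hu' hv'
    intro u v h
    rcases lt_trichotomy (f u) (f v) with huv | huv | huv
    · exact key u v huv h
    · simp [Conflict, huv, loopless] at h
    · exact key v u huv h.symm

/-- Outside the component `B ∪ D`, an absent diagonal asks only for two vertices, and one of them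
alone can be `A`. A full diagonal asks for a second and a third complement component, and one of
them can be `A`. With a dotted diagonal `A ∪ C` is itself a complement component that splits, by the
symmetric argument. -/
theorem hPartition_fullCycle_dotted_iff (k : Option EdgeKind) :
    (fullCycle k (some .dotted)).HPartition V G ↔ ∃ x, Splits G x ∧ RestDivides G x k := by
  constructor
  · rintro ⟨f, hsurj, hfull, hdot⟩
    obtain ⟨a, ha⟩ := hsurj 0
    obtain ⟨b, hb⟩ := hsurj 1
    obtain ⟨c, hc⟩ := hsurj 2
    obtain ⟨d, hd⟩ := hsurj 3
    have hjoin : ∀ u v, (f u = 1 ∨ f u = 3) → ¬ (f v = 1 ∨ f v = 3) → G.Adj u v := by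
      intro u v hu hv
      have hv' : f v = 0 ∨ f v = 2 := by omega
      apply hfull
      rcases hu with hu | hu <;> rcases hv' with hv | hv <;> rw [hu, hv] <;> rfl
    obtain ⟨h1, h2⟩ := splits_of_classes (P := (f · = 1)) (Q := (f · = 3)) hb hd
      (fun u v hu hv => ⟨by rintro rfl; omega, hdot u v (by rw [hu, hv]; rfl)⟩) hjoin
    have hna : ¬ CoReach G b a := by simp [h2, ha]
    have hnc : ¬ CoReach G b c := by simp [h2, hc]
    refine ⟨b, h1, ?_⟩
    rcases k with _ | _ | _
    · exact ⟨a, c, by rintro rfl; omega, hna, hnc⟩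
    · refine ⟨a, c, fun h => ?_, hna, hnc⟩
      -- With a full diagonal the class `A` is complete to all other classes, so no complement walk
      -- leads from `a` to `c`.
      have := coReach_closed (P := (f · = 0)) (fun u v hu hv => hfull u v ?_) h ha
      · omega
      · have : f v = 1 ∨ f v = 2 ∨ f v = 3 := by omega
        rcases this with hv | hv | hv <;> rw [hu, hv] <;> rfl
    · obtain ⟨h3, h4⟩ := splits_of_classes (P := (f · = 0)) (Q := (f · = 2)) ha hc
        (fun u v hu hv => ⟨by rintro rfl; omega, hdot u v (by rw [hu, hv]; rfl)⟩)
        (fun u v hu hv => (hjoin v u (by omega) (by omega)).symm)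
      refine ⟨a, h3, hna, fun z => ?_⟩
      rw [h2, h4]
      omega
  · rintro ⟨x, hx, h⟩
    rcases k with _ | _ | _
    · obtain ⟨y, z, hyz, hy, hz⟩ := h
      exact hPartition_of_splits (R := (· = y)) hx hy rfl hz (Ne.symm hyz) (by simp)
    · obtain ⟨y, z, hyz, hy, hz⟩ := h
      refine hPartition_of_splits (R := CoReach G y) hx hy (.refl _) hz hyz fun u v _ _ hu hv => ?_
      simpa using adj_of_not_coReach hu hv
    · obtain ⟨y, ⟨z, hyz, hyz'⟩, hy, hall⟩ := h
      refine hPartition_of_splits (R := InReach G y) hx hy .refl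
        (fun hz => hy (hz.trans hyz.symm)) hyz' fun u v _ hv hu hv' => ?_
      simpa using not_adj_of_not_inReach hu ((hall v).resolve_left hv) hv'

end ModelGraph

/-! ## A program for the joins -/

namespace JoinProgram

open Datalog

/-- The intensional symbols: `rel false` is adjacency or equality, `rel true` is nonadjacency. -/
inductive Sym where
  | rel (c : Bool) | eq | co | within | splits | third | goal

/-- Their arities. -/
abbrev arity : Sym → ℕ
  | .rel _ => 2
  | .eq => 2
  | .co => 2
  | .within => 2
  | .splits => 1
  | .third => 2
  | .goal => 0

instance : Finite Sym :=
  Finite.of_surjective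
    (![.rel false, .rel true, .eq, .co, .within, .splits, .third, .goal] : Fin 8 → Sym) <| by
    rintro ((_ | _) | _ | _ | _ | _ | _ | _)
    exacts [⟨0, rfl⟩, ⟨1, rfl⟩, ⟨2, rfl⟩, ⟨3, rfl⟩, ⟨4, rfl⟩, ⟨5, rfl⟩, ⟨6, rfl⟩, ⟨7, rfl⟩]

/-- The variable `X`. -/
abbrev X : Term := .var 0
/-- The variable `Y`. -/
abbrev Y : Term := .var 1
/-- The variable `Z`. -/
abbrev Z : Term := .var 2

/-- `vert(x)` -/
def vert (x : Term) : Atom arity := ⟨.vert, ![x]⟩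
/-- `edge(x, y)` -/
def edge (x y : Term) : Atom arity := ⟨.edge, ![x, y]⟩
/-- `rel c (x, y)` -/
def rel (c : Bool) (x y : Term) : Atom arity := ⟨.idb (.rel c), ![x, y]⟩
/-- `eq(x, y)` -/
def eq (x y : Term) : Atom arity := ⟨.idb .eq, ![x, y]⟩
/-- `co(x, y)` -/
def co (x y : Term) : Atom arity := ⟨.idb .co, ![x, y]⟩
/-- `within(x, y)` -/
def within (x y : Term) : Atom arity := ⟨.idb .within, ![x, y]⟩
/-- `splits(x)` -/
def splits (x : Term) : Atom arity := ⟨.idb .splits, ![x]⟩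
/-- `third(x, y)` -/
def third (x y : Term) : Atom arity := ⟨.idb .third, ![x, y]⟩

/-- The rule that derives the goal. -/
def goalRule : Option EdgeKind → Rule arity
  | none => ⟨.goal, ![], [splits X, vert Y, vert Z], [eq Y Z, co X Y, co X Z]⟩
  | some .full => ⟨.goal, ![], [splits X, vert Y, vert Z], [co Y Z, co X Y, co X Z]⟩
  | some .dotted => ⟨.goal, ![], [splits X, splits Y], [co X Y, third X Y]⟩

/-- The program that decides whether the graph (for `c = false`) or its complement (for `c = true`)
has a partition for the full 4-cycle with one diagonal of type `k` and one dotted diagonal. -/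
def program (c : Bool) (k : Option EdgeKind) : Program arity :=
  [ ⟨.rel false, ![X, Y], [edge X Y], []⟩,
    ⟨.rel false, ![X, X], [vert X], []⟩,
    ⟨.rel true, ![X, Y], [vert X, vert Y], [edge X Y]⟩,
    ⟨.eq, ![X, X], [vert X], []⟩,
    ⟨.co, ![X, Y], [rel (!c) X Y], []⟩,
    ⟨.co, ![X, Z], [co X Y, rel (!c) Y Z], []⟩,
    ⟨.within, ![X, Y], [rel c X Y, co X Y], []⟩,
    ⟨.within, ![X, Z], [within X Y, rel c Y Z, co Y Z], []⟩,
    ⟨.splits, ![X], [co X Y], [within X Y]⟩,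
    ⟨.third, ![X, Y], [vert X, vert Y, vert Z], [co X Z, co Y Z]⟩,
    goalRule k ]

/-- A stratification. -/
def level : Sym → ℕ
  | .rel _ | .eq | .co | .within => 0
  | .splits | .third => 1
  | .goal => 2

theorem isStratification (c : Bool) (k : Option EdgeKind) :
    IsStratification (program c k) level := by
  intro r hr
  simp only [program, List.mem_cons, List.not_mem_nil, or_false] at hr
  rcases hr with rfl | rfl | rfl | rfl | rfl | rfl | rfl | rfl | rfl | rfl | rfl
  case inr.inr.inr.inr.inr.inr.inr.inr.inr.inr =>
    rcases k with _ | _ | _ <;> simp [goalRule, vert, eq, co, splits, third, level]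
  all_goals simp [vert, edge, rel, co, within, level]

/-! ### Variables and ground instances of the atoms. -/

section atoms

variable {x y : Term} {z : ℕ} {c : Bool} {s : ℕ → ℕ}

theorem hasVar_vert : (vert x).HasVar z ↔ x = .var z := by
  change (∃ n : Fin 1, (![x] : Fin 1 → Term) n = _) ↔ _
  simp

theorem exists_pair_eq_var : (∃ n, ![x, y] n = .var z) ↔ x = .var z ∨ y = .var z := by
  simp

theorem hasVar_edge : (edge x y).HasVar z ↔ x = .var z ∨ y = .var z := exists_pair_eq_var

theorem hasVar_rel : (rel c x y).HasVar z ↔ x = .var z ∨ y = .var z := exists_pair_eq_var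

theorem hasVar_eq : (eq x y).HasVar z ↔ x = .var z ∨ y = .var z := exists_pair_eq_var

theorem hasVar_co : (co x y).HasVar z ↔ x = .var z ∨ y = .var z := exists_pair_eq_var

theorem hasVar_within : (within x y).HasVar z ↔ x = .var z ∨ y = .var z := exists_pair_eq_var

theorem hasVar_third : (third x y).HasVar z ↔ x = .var z ∨ y = .var z := exists_pair_eq_var

theorem hasVar_splits : (splits x).HasVar z ↔ x = .var z := by
  change (∃ n : Fin 1, (![x] : Fin 1 → Term) n = _) ↔ _
  simp

/-- A fact about an intensional symbol. -/
abbrev fact (i : Sym) (v : Fin (arity i) → ℕ) : Fact arity := ⟨.idb i, v⟩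

theorem ground_vert : (vert x).ground s = ⟨.vert, ![x.eval s]⟩ :=
  fact_ext (R := .vert) fun n : Fin 1 => by fin_cases n; rfl

theorem ground_edge : (edge x y).ground s = ⟨.edge, ![x.eval s, y.eval s]⟩ :=
  fact_ext (R := .edge) fun n : Fin 2 => by fin_cases n <;> rfl

theorem ground_rel : (rel c x y).ground s = fact (.rel c) ![x.eval s, y.eval s] :=
  fact_ext (R := .idb (Sym.rel c)) fun n : Fin 2 => by fin_cases n <;> rfl

theorem ground_eq : (eq x y).ground s = fact .eq ![x.eval s, y.eval s] :=
  fact_ext (R := .idb Sym.eq) fun n : Fin 2 => by fin_cases n <;> rfl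

theorem ground_co : (co x y).ground s = fact .co ![x.eval s, y.eval s] :=
  fact_ext (R := .idb Sym.co) fun n : Fin 2 => by fin_cases n <;> rfl

theorem ground_within : (within x y).ground s = fact .within ![x.eval s, y.eval s] :=
  fact_ext (R := .idb Sym.within) fun n : Fin 2 => by fin_cases n <;> rfl

theorem ground_third : (third x y).ground s = fact .third ![x.eval s, y.eval s] :=
  fact_ext (R := .idb Sym.third) fun n : Fin 2 => by fin_cases n <;> rfl

theorem ground_splits : (splits x).ground s = fact .splits ![x.eval s] :=
  fact_ext (R := .idb Sym.splits) fun n : Fin 1 => by fin_cases n; rfl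

theorem fact_goal (v : Fin 0 → ℕ) : fact .goal v = fact .goal ![] :=
  congrArg (fact .goal) (Subsingleton.elim (α := Fin 0 → ℕ) v ![])

end atoms

theorem safe (c : Bool) (k : Option EdgeKind) : ∀ r ∈ program c k, r.Safe := by
  intro r hr
  have heads : ∀ (r : Rule arity) (a : Atom arity), r.head = a →
      (∀ z, (a.HasVar z ∨ ∃ b ∈ r.neg, b.HasVar z) → ∃ b ∈ r.pos, b.HasVar z) → r.Safe :=
    fun r a ha h => by subst ha; exact h
  simp only [program, List.mem_cons, List.not_mem_nil, or_false] at hr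
  rcases hr with rfl | rfl | rfl | rfl | rfl | rfl | rfl | rfl | rfl | rfl | rfl
  · refine heads _ (rel false X Y) rfl ?_
    simp [hasVar_rel, hasVar_edge]
  · refine heads _ (rel false X X) rfl ?_
    simp [hasVar_rel, hasVar_vert]
  · refine heads _ (rel true X Y) rfl ?_
    simp [hasVar_rel, hasVar_edge, hasVar_vert]
  · refine heads _ (eq X X) rfl ?_
    simp [hasVar_eq, hasVar_vert]
  · refine heads _ (co X Y) rfl ?_
    simp [hasVar_rel, hasVar_co]
  · refine heads _ (co X Z) rfl ?_
    simp [hasVar_rel, hasVar_co]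
    grind
  · refine heads _ (within X Y) rfl ?_
    simp [hasVar_rel, hasVar_co, hasVar_within]
  · refine heads _ (within X Z) rfl ?_
    simp [hasVar_rel, hasVar_co, hasVar_within]
    grind
  · refine heads _ (splits X) rfl ?_
    simp [hasVar_co, hasVar_within, hasVar_splits]
  · refine heads _ (third X Y) rfl ?_
    simp [hasVar_co, hasVar_third, hasVar_vert]
    grind
  · rintro z (⟨n, -⟩ | ⟨a, ha, hz⟩)
    · rcases k with _ | _ | _ <;> exact Fin.elim0 n
    · revert a
      rcases k with _ | _ | _ <;>
        simp [goalRule, hasVar_co, hasVar_third, hasVar_vert, hasVar_splits, hasVar_eq] <;> grind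

/-- The set `C` contains all heads of instances of rules whose positive atoms are in `N` and whose
negated atoms are not in `M`. -/
structure Consequences (c : Bool) (k : Option EdgeKind) (N M C : Set (Fact arity)) : Prop where
  rel_edge : ∀ x y, ⟨.edge, ![x, y]⟩ ∈ N → fact (.rel false) ![x, y] ∈ C
  rel_refl : ∀ x, ⟨.vert, ![x]⟩ ∈ N → fact (.rel false) ![x, x] ∈ C
  rel_compl : ∀ x y, ⟨.vert, ![x]⟩ ∈ N → ⟨.vert, ![y]⟩ ∈ N → ⟨.edge, ![x, y]⟩ ∉ M →
    fact (.rel true) ![x, y] ∈ C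
  eq : ∀ x, ⟨.vert, ![x]⟩ ∈ N → fact .eq ![x, x] ∈ C
  co : ∀ x y, fact (.rel !c) ![x, y] ∈ N → fact .co ![x, y] ∈ C
  co_trans : ∀ x y z, fact .co ![x, y] ∈ N → fact (.rel !c) ![y, z] ∈ N → fact .co ![x, z] ∈ C
  within : ∀ x y, fact (.rel c) ![x, y] ∈ N → fact .co ![x, y] ∈ N → fact .within ![x, y] ∈ C
  within_trans : ∀ x y z, fact .within ![x, y] ∈ N → fact (.rel c) ![y, z] ∈ N →
    fact .co ![y, z] ∈ N → fact .within ![x, z] ∈ C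
  splits : ∀ x y, fact .co ![x, y] ∈ N → fact .within ![x, y] ∉ M → fact .splits ![x] ∈ C
  third : ∀ x y z, ⟨.vert, ![x]⟩ ∈ N → ⟨.vert, ![y]⟩ ∈ N → ⟨.vert, ![z]⟩ ∈ N →
    fact .co ![x, z] ∉ M → fact .co ![y, z] ∉ M → fact .third ![x, y] ∈ C
  goal : ∀ s, (∀ a ∈ (goalRule k).pos, a.ground s ∈ N) →
    (∀ a ∈ (goalRule k).neg, a.ground s ∉ M) → fact .goal ![] ∈ C

theorem goalRule_head (k : Option EdgeKind) (s : ℕ → ℕ) :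
    (goalRule k).head.ground s = fact .goal ![] := by
  rcases k with _ | _ | _ <;> exact fact_goal _

/-- The valuation of the variables. -/
def valuation (x y z : ℕ) (n : ℕ) : ℕ := [x, y, z].getD n 0

@[simp]
theorem eval_X (x y z : ℕ) : X.eval (valuation x y z) = x := rfl

@[simp]
theorem eval_Y (x y z : ℕ) : Y.eval (valuation x y z) = y := rfl

@[simp]
theorem eval_Z (x y z : ℕ) : Z.eval (valuation x y z) = z := rfl

/-- The goal rule depends on `k` and is therefore kept in terms of valuations; the other rules
become conditions on facts. -/
theorem consequences_iff {c : Bool} {k : Option EdgeKind} {N M C : Set (Fact arity)} :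
    (∀ r ∈ program c k, ∀ s, (∀ a ∈ r.pos, a.ground s ∈ N) → (∀ a ∈ r.neg, a.ground s ∉ M) →
      r.head.ground s ∈ C) ↔ Consequences c k N M C := by
  rw [program]
  simp only [List.forall_mem_cons, ground_vert, ground_edge, ground_rel, ground_co, ground_within]
  constructor
  · rintro ⟨h1, h2, h3, h4, h5, h6, h7, h8, h9, h10, h11, -⟩
    refine ⟨fun x y hx => ?_, fun x hx => ?_, fun x y hx hy hxy => ?_, fun x hx => ?_,
      fun x y hx => ?_, fun x y z hx hy => ?_, fun x y hx hy => ?_, fun x y z hx hy hz => ?_,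
      fun x y hx hy => ?_, fun x y z hx hy hz hxz hyz => ?_, fun s hpos hneg => ?_⟩
    · have : (rel false X Y).ground (valuation x y 0) ∈ C := h1 _ (by simpa using hx) (by simp)
      rwa [ground_rel] at this
    · have : (rel false X X).ground (valuation x 0 0) ∈ C := h2 _ (by simpa using hx) (by simp)
      rwa [ground_rel] at this
    · have : (rel true X Y).ground (valuation x y 0) ∈ C :=
        h3 _ (by simpa using ⟨hx, hy⟩) (by simpa using hxy)
      rwa [ground_rel] at this
    · have : (JoinProgram.eq X X).ground (valuation x 0 0) ∈ C :=
        h4 _ (by simpa using hx) (by simp)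
      rwa [ground_eq] at this
    · have : (JoinProgram.co X Y).ground (valuation x y 0) ∈ C :=
        h5 _ (by simpa using hx) (by simp)
      rwa [ground_co] at this
    · have : (JoinProgram.co X Z).ground (valuation x y z) ∈ C :=
        h6 _ (by simpa using ⟨hx, hy⟩) (by simp)
      rwa [ground_co] at this
    · have : (JoinProgram.within X Y).ground (valuation x y 0) ∈ C :=
        h7 _ (by simpa using ⟨hx, hy⟩) (by simp)
      rwa [ground_within] at this
    · have : (JoinProgram.within X Z).ground (valuation x y z) ∈ C :=
        h8 _ (by simpa using ⟨hx, hy, hz⟩) (by simp)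
      rwa [ground_within] at this
    · have : (JoinProgram.splits X).ground (valuation x y 0) ∈ C :=
        h9 _ (by simpa using hx) (by simpa using hy)
      rwa [ground_splits] at this
    · have : (JoinProgram.third X Y).ground (valuation x y z) ∈ C :=
        h10 _ (by simpa using ⟨hx, hy, hz⟩) (by simpa using ⟨hxz, hyz⟩)
      rwa [ground_third] at this
    · exact goalRule_head k s ▸ h11 s hpos hneg
  · intro h
    refine ⟨fun s hp hn => ?_, fun s hp hn => ?_, fun s hp hn => ?_, fun s hp hn => ?_,
      fun s hp hn => ?_, fun s hp hn => ?_, fun s hp hn => ?_, fun s hp hn => ?_,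
      fun s hp hn => ?_, fun s hp hn => ?_, fun s hp hn => ?_, by simp⟩
    · exact ground_rel (x := X) (y := Y) (s := s) ▸ h.rel_edge _ _ hp.1
    · exact ground_rel (x := X) (y := X) (s := s) ▸ h.rel_refl _ hp.1
    · exact ground_rel (x := X) (y := Y) (s := s) ▸ h.rel_compl _ _ hp.1 hp.2.1 hn.1
    · exact ground_eq (x := X) (y := X) (s := s) ▸ h.eq _ hp.1
    · exact ground_co (x := X) (y := Y) (s := s) ▸ h.co _ _ hp.1
    · exact ground_co (x := X) (y := Z) (s := s) ▸ h.co_trans _ _ _ hp.1 hp.2.1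
    · exact ground_within (x := X) (y := Y) (s := s) ▸ h.within _ _ hp.1 hp.2.1
    · exact ground_within (x := X) (y := Z) (s := s) ▸
        h.within_trans _ _ _ hp.1 hp.2.1 hp.2.2.1
    · exact ground_splits (x := X) (s := s) ▸ h.splits _ _ hp.1 hn.1
    · exact ground_third (x := X) (y := Y) (s := s) ▸
        h.third _ _ _ hp.1 hp.2.1 hp.2.2.1 hn.1 hn.2.1
    · exact goalRule_head k s ▸ h.goal s hp hn

/-! ### Semantics -/

variable {V : Type} {G : SimpleGraph V} {name : V ↪ ℕ} {c : Bool} {k : Option EdgeKind}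

/-- The graph or its complement. -/
def effective (G : SimpleGraph V) : Bool → SimpleGraph V
  | false => G
  | true => Gᶜ

theorem compl_effective (G : SimpleGraph V) (c : Bool) :
    (effective G c)ᶜ = effective G !c := by
  cases c
  · rfl
  · exact compl_compl G

/-- The binary fact `v` names a pair of vertices that is in the relation `R`. -/
def Names (name : V ↪ ℕ) (R : V → V → Prop) (v : Fin 2 → ℕ) : Prop :=
  ∃ x y, R x y ∧ v = ![name x, name y]

theorem names_iff {R : V → V → Prop} {x y : V} : Names name R ![name x, name y] ↔ R x y := by
  refine ⟨?_, fun h => ⟨x, y, h, rfl⟩⟩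
  rintro ⟨x', y', h, he⟩
  rwa [name.injective (congrFun he 0), name.injective (congrFun he 1)]

/-- What the facts of the model tell. -/
def Supported (c : Bool) (k : Option EdgeKind) (G : SimpleGraph V) (name : V ↪ ℕ)
    (M : Set (Fact arity)) : Fact arity → Prop
  | ⟨.vert, _⟩ => True
  | ⟨.edge, _⟩ => True
  | ⟨.idb (.rel d), v⟩ => Names name (fun x y => x = y ∨ (effective G d).Adj x y) v
  | ⟨.idb .eq, v⟩ => Names name (fun x y => x = y) v
  | ⟨.idb .co, v⟩ => Names name (ModelGraph.CoReach (effective G c)) v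
  | ⟨.idb .within, v⟩ => Names name (ModelGraph.InReach (effective G c)) v
  | ⟨.idb .splits, v⟩ => ∃ x y, fact .co ![x, y] ∈ M ∧ fact .within ![x, y] ∉ M ∧ v = ![x]
  | ⟨.idb .third, v⟩ => ∃ x y z, ⟨.vert, ![z]⟩ ∈ M ∧ fact .co ![x, z] ∉ M ∧
      fact .co ![y, z] ∉ M ∧ v = ![x, y]
  | ⟨.idb .goal, _⟩ => ∃ s, (∀ a ∈ (goalRule k).pos, a.ground s ∈ M) ∧
      ∀ a ∈ (goalRule k).neg, a.ground s ∉ M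

/-- The model of the program on a graph. -/
abbrev graphModel (c : Bool) (k : Option EdgeKind) (G : SimpleGraph V) (name : V ↪ ℕ) :
    Set (Fact arity) :=
  model (program c k) level (graphFacts arity G name)

theorem consequences_graphModel :
    Consequences c k (graphModel c k G name) (graphModel c k G name) (graphModel c k G name) :=
  consequences_iff.1 fun _ hr s => head_mem_model (isStratification c k) hr s

theorem vert_mem (x : V) : (⟨.vert, ![name x]⟩ : Fact arity) ∈ graphModel c k G name :=
  vert_mem_model.2 ⟨x, rfl⟩

/-- Injectivity of `name` identifies the two middle vertices. -/
theorem names_trans {R S T : V → V → Prop} (h : ∀ x y z, R x y → S y z → T x z) {x y z : ℕ}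
    (hR : Names name R ![x, y]) (hS : Names name S ![y, z]) : Names name T ![x, z] := by
  obtain ⟨x', y', hR, he⟩ := hR
  obtain ⟨y'', z', hS, he'⟩ := hS
  obtain rfl : y' = y'' := name.injective ((congrFun he 1).symm.trans (congrFun he' 0))
  obtain rfl : x = name x' := congrFun he 0
  obtain rfl : z = name z' := congrFun he' 1
  exact ⟨x', z', h _ _ _ hR hS, rfl⟩

theorem names_and {R S T : V → V → Prop} (h : ∀ x y, R x y → S x y → T x y) {v : Fin 2 → ℕ}
    (hR : Names name R v) (hS : Names name S v) : Names name T v := by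
  obtain ⟨x, y, hR, rfl⟩ := hR
  exact ⟨x, y, h x y hR (names_iff.1 hS), rfl⟩

theorem coReach_of_rel {x y : V} (h : x = y ∨ (effective G !c).Adj x y) :
    ModelGraph.CoReach (effective G c) x y := by
  rcases h with rfl | h
  · exact SimpleGraph.Reachable.refl _
  · rw [← compl_effective] at h
    exact h.reachable

/-- The recursive symbols `co` and `within` are bounded by their meaning in the graph, by induction
over derivations. `splits` and `third` use negation and are only inverted by one rule; their meaning
follows once `co` and `within` are known exactly. -/
theorem supported_consequences :
    Consequences c k
      (graphModel c k G name ∩ {x | Supported c k G name (graphModel c k G name) x})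
      (graphModel c k G name) {x | Supported c k G name (graphModel c k G name) x} where
  rel_edge x y h := by
    obtain ⟨u, v, huv, rfl, rfl⟩ := edge_mem_model.1 h.1
    exact ⟨u, v, Or.inr huv, rfl⟩
  rel_refl x h := by
    obtain ⟨u, rfl⟩ := vert_mem_model.1 h.1
    exact ⟨u, u, Or.inl rfl, rfl⟩
  rel_compl x y h h' h'' := by
    obtain ⟨u, rfl⟩ := vert_mem_model.1 h.1
    obtain ⟨v, rfl⟩ := vert_mem_model.1 h'.1
    refine ⟨u, v, or_iff_not_imp_left.2 fun hne => ?_, rfl⟩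
    exact (SimpleGraph.compl_adj _ _ _).2
      ⟨hne, fun h => h'' (edge_mem_model.2 ⟨u, v, h, rfl, rfl⟩)⟩
  eq x h := by
    obtain ⟨u, rfl⟩ := vert_mem_model.1 h.1
    exact ⟨u, u, rfl, rfl⟩
  co x y h := by
    obtain ⟨u, v, h, he⟩ := h.2
    exact ⟨u, v, coReach_of_rel h, he⟩
  co_trans x y z h h' := names_trans (fun _ _ _ h h' => h.trans (coReach_of_rel h')) h.2 h'.2
  within x y h h' := names_and (fun x y h h' => by
    rcases h with rfl | h
    · exact .refl
    · exact .single ⟨h, h'⟩) h.2 h'.2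
  within_trans x y z h h' h'' := by
    -- The `rel` and `co` facts about the same pair combine into equality or one step of `InReach`;
    -- equality occurs because `rel` is reflexive.
    refine names_trans (fun x y z h h' => ?_) h.2
      (names_and (T := fun y z => y = z ∨ (effective G c).Adj y z ∧
        ModelGraph.CoReach (effective G c) y z) (fun y z h h' => ?_) h'.2 h''.2)
    · rcases h' with rfl | h'
      · exact h
      · exact h.tail h'
    · exact h.imp id fun h => ⟨h, h'⟩
  splits x y h h' := ⟨x, y, h.1, h', rfl⟩
  third x y z _ _ h h' h'' := ⟨x, y, z, h.1, h', h'', rfl⟩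
  goal s h h' := ⟨s, fun a ha => (h a ha).1, h'⟩

theorem supported {x : Fact arity} (hx : x ∈ graphModel c k G name) :
    Supported c k G name (graphModel c k G name) x := by
  refine model_induction (Q := Supported c k G name (graphModel c k G name))
    (isStratification c k) ?_ (consequences_iff.2 supported_consequences) hx
  rintro x (⟨v, rfl⟩ | ⟨u, v, _, rfl⟩) <;> trivial

theorem rel_mem {d : Bool} {x y : V} (h : x = y ∨ (effective G d).Adj x y) :
    fact (.rel d) ![name x, name y] ∈ graphModel c k G name := by
  cases d
  · rcases h with rfl | h
    · exact consequences_graphModel.rel_refl _ (vert_mem x)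
    · exact consequences_graphModel.rel_edge _ _ (edge_mem_model.2 ⟨x, y, h, rfl, rfl⟩)
  · refine consequences_graphModel.rel_compl _ _ (vert_mem x) (vert_mem y) fun h' => ?_
    obtain ⟨u, v, huv, hu, hv⟩ := edge_mem_model.1 h'
    obtain rfl := name.injective hu
    obtain rfl := name.injective hv
    rcases h with rfl | h
    · exact G.irrefl huv
    · exact ((SimpleGraph.compl_adj _ _ _).1 h).2 huv

theorem eq_mem {x y : V} : fact .eq ![name x, name y] ∈ graphModel c k G name ↔ x = y := by
  refine ⟨fun h => names_iff.1 (supported h), ?_⟩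
  rintro rfl
  exact consequences_graphModel.eq _ (vert_mem x)

theorem co_mem {x y : V} : fact .co ![name x, name y] ∈ graphModel c k G name ↔
    ModelGraph.CoReach (effective G c) x y := by
  refine ⟨fun h => names_iff.1 (supported h), fun h => ?_⟩
  rw [ModelGraph.CoReach, SimpleGraph.reachable_iff_reflTransGen, compl_effective] at h
  induction h with
  | refl => exact consequences_graphModel.co _ _ (rel_mem (Or.inl rfl))
  | tail _ h ih => exact consequences_graphModel.co_trans _ _ _ ih (rel_mem (Or.inr h))

theorem within_mem {x y : V} : fact .within ![name x, name y] ∈ graphModel c k G name ↔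
    ModelGraph.InReach (effective G c) x y := by
  refine ⟨fun h => names_iff.1 (supported h), fun h => ?_⟩
  induction h with
  | refl =>
    exact consequences_graphModel.within _ _ (rel_mem (Or.inl rfl)) (co_mem.2 (.refl _))
  | tail _ h ih =>
    exact consequences_graphModel.within_trans _ _ _ ih (rel_mem (Or.inr h.1)) (co_mem.2 h.2)

theorem splits_mem {x : ℕ} : fact .splits ![x] ∈ graphModel c k G name ↔
    ∃ u, x = name u ∧ ModelGraph.Splits (effective G c) u := by
  constructor
  · intro h
    obtain ⟨x', y, hco, hw, h⟩ := supported h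
    obtain rfl : x = x' := congrFun h 0
    obtain ⟨u, v, huv, he⟩ := supported hco
    obtain rfl : x = name u := congrFun he 0
    obtain rfl : y = name v := congrFun he 1
    exact ⟨u, rfl, v, huv, fun h => hw (within_mem.2 h)⟩
  · rintro ⟨u, rfl, v, huv, hn⟩
    exact consequences_graphModel.splits _ _ (co_mem.2 huv) fun h => hn (within_mem.1 h)

/-- `third` serves to be negated: its failure is the universal statement that two complement
components cover the graph. -/
theorem third_mem {x y : V} : fact .third ![name x, name y] ∈ graphModel c k G name ↔
    ∃ z, ¬ ModelGraph.CoReach (effective G c) x z ∧ ¬ ModelGraph.CoReach (effective G c) y z := by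
  constructor
  · intro h
    obtain ⟨x', y', z, hz, hx, hy, h⟩ := supported h
    obtain rfl : name x = x' := congrFun h 0
    obtain rfl : name y = y' := congrFun h 1
    obtain ⟨w, rfl⟩ := vert_mem_model.1 hz
    exact ⟨w, fun h => hx (co_mem.2 h), fun h => hy (co_mem.2 h)⟩
  · rintro ⟨z, hx, hy⟩
    exact consequences_graphModel.third _ _ _ (vert_mem x) (vert_mem y) (vert_mem z)
      (fun h => hx (co_mem.1 h)) fun h => hy (co_mem.1 h)

theorem goal_mem : fact .goal ![] ∈ graphModel c k G name ↔
    ∃ x, ModelGraph.Splits (effective G c) x ∧ ModelGraph.RestDivides (effective G c) x k := by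
  constructor
  · intro h
    obtain ⟨s, hp, hn⟩ := supported h
    rcases k with _ | _ | _ <;>
    simp only [goalRule, List.forall_mem_cons, ground_splits, ground_vert, ground_eq, ground_co,
      ground_third, vert_mem_model, splits_mem] at hp hn
    · obtain ⟨⟨x, hx, hs⟩, ⟨y, hy⟩, ⟨z, hz⟩, -⟩ := hp
      rw [hx, ← hy, ← hz, eq_mem, co_mem, co_mem] at hn
      exact ⟨x, hs, y, z, hn.1, hn.2.1, hn.2.2.1⟩
    · obtain ⟨⟨x, hx, hs⟩, ⟨y, hy⟩, ⟨z, hz⟩, -⟩ := hp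
      rw [hx, ← hy, ← hz, co_mem, co_mem, co_mem] at hn
      exact ⟨x, hs, y, z, hn.1, hn.2.1, hn.2.2.1⟩
    · obtain ⟨⟨x, hx, hs⟩, ⟨y, hy, ht⟩, -⟩ := hp
      rw [hx, hy, co_mem, third_mem] at hn
      refine ⟨x, hs, y, ht, hn.1, fun z => ?_⟩
      by_contra! h
      exact hn.2.1 ⟨z, h⟩
  · rintro ⟨x, hs, h⟩
    rcases k with _ | _ | _
    · obtain ⟨y, z, hyz, hy, hz⟩ := h
      refine consequences_graphModel.goal (valuation (name x) (name y) (name z)) ?_ ?_ <;>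
      simp only [goalRule, List.forall_mem_cons, ground_splits, ground_vert, ground_eq, ground_co,
        splits_mem, eval_X, eval_Y, eval_Z, eq_mem, co_mem]
      · exact ⟨⟨x, rfl, hs⟩, vert_mem y, vert_mem z, by simp⟩
      · exact ⟨hyz, hy, hz, by simp⟩
    · obtain ⟨y, z, hyz, hy, hz⟩ := h
      refine consequences_graphModel.goal (valuation (name x) (name y) (name z)) ?_ ?_ <;>
      simp only [goalRule, List.forall_mem_cons, ground_splits, ground_vert, ground_co,
        splits_mem, eval_X, eval_Y, eval_Z, co_mem]
      · exact ⟨⟨x, rfl, hs⟩, vert_mem y, vert_mem z, by simp⟩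
      · exact ⟨hyz, hy, hz, by simp⟩
    · obtain ⟨y, ht, hy, hall⟩ := h
      -- The goal rule for a dotted diagonal has no variable `Z`, so its value is arbitrary.
      refine consequences_graphModel.goal (valuation (name x) (name y) 0) ?_ ?_ <;>
      simp only [goalRule, List.forall_mem_cons, ground_splits, ground_third, ground_co,
        splits_mem, eval_X, eval_Y, third_mem, co_mem]
      · exact ⟨⟨x, rfl, hs⟩, ⟨y, rfl, ht⟩, by simp⟩
      · refine ⟨hy, ?_, by simp⟩
        rintro ⟨z, h1, h2⟩
        exact (hall z).elim h1 h2

theorem stratifiedDecides (c : Bool) (k : Option EdgeKind) :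
    StratifiedDecides (program c k) .goal fun V G =>
      (ModelGraph.fullCycle k (some .dotted)).HPartition V (effective G c) := by
  refine ⟨rfl, safe c k, level, isStratification c k, fun V _ G name => ?_⟩
  refine Iff.trans ?_ ((goal_mem (name := name)).trans
    (ModelGraph.hPartition_fullCycle_dotted_iff k).symm)
  refine ⟨fun ⟨t, ht⟩ => ?_, fun h => ⟨_, h⟩⟩
  rwa [show t = ![] from Subsingleton.elim (α := Fin 0 → ℕ) _ _] at ht

end JoinProgram

/-! ## Equivalent model graphs -/

namespace ModelGraph

variable {V : Type} {G : SimpleGraph V} {H K : ModelGraph}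

/-- The implication `x = y → p = q` holds because a labeling is a function. It is needed for `G' =
Gᶜ`: complementation does not turn nonadjacency of a vertex to itself into adjacency, so the
diagonal must be settled by looplessness of the model graph. -/
theorem hPartition_of_relabel {G' : SimpleGraph V} (π : Equiv.Perm (Fin 4))
    (h : ∀ x p y q, (x = y → p = q) → K.Conflict G' x p y q → H.Conflict G x (π p) y (π q)) :
    H.HPartition V G → K.HPartition V G' := by
  rintro ⟨f, hf⟩
  rw [isPartition_iff] at hf
  refine ⟨fun x => π.symm (f x), isPartition_iff.2 ⟨π.symm.surjective.comp hf.1, fun x y hc => ?_⟩⟩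
  have := h _ _ _ _ (by rintro rfl; rfl) hc
  rw [π.apply_symm_apply, π.apply_symm_apply] at this
  exact hf.2 x y this

theorem hPartition_iff_of_perm (π : Equiv.Perm (Fin 4))
    (h : ∀ p q, H.edge (π p) (π q) = K.edge p q) : H.HPartition V G ↔ K.HPartition V G := by
  constructor
  · refine hPartition_of_relabel π fun x p y q _ hc => ?_
    rwa [Conflict, h]
  · refine hPartition_of_relabel π.symm fun x p y q _ hc => ?_
    rwa [Conflict, ← h, π.apply_symm_apply, π.apply_symm_apply]

theorem conflict_compl {x y : V} {p q p' q' : Fin 4} (hxy : x ≠ y)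
    (h : H.edge p' q' = (K.edge p q).map EdgeKind.swap) :
    H.Conflict G x p' y q' ↔ K.Conflict Gᶜ x p y q := by
  rw [Conflict, Conflict, h, SimpleGraph.compl_adj]
  rcases K.edge p q with _ | _ | _ <;> simp [EdgeKind.swap, hxy]

theorem hPartition_iff_of_perm_swap (π : Equiv.Perm (Fin 4))
    (h : ∀ p q, H.edge (π p) (π q) = (K.edge p q).map EdgeKind.swap) :
    H.HPartition V G ↔ K.HPartition V Gᶜ := by
  constructor
  · refine hPartition_of_relabel π fun x p y q hpq hc => ?_
    by_cases hxy : x = y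
    · simp [Conflict, hpq hxy, loopless] at hc
    · exact (conflict_compl hxy (h p q)).2 hc
  · refine hPartition_of_relabel π.symm fun x p y q hpq hc => ?_
    by_cases hxy : x = y
    · simp [Conflict, hpq hxy, loopless] at hc
    · refine (conflict_compl hxy ?_).1 hc
      rw [← h, π.apply_symm_apply, π.apply_symm_apply]

theorem expressible_of_equivalent {k : Option EdgeKind}
    (h : H.Equivalent (fullCycle k (some .dotted))) : Datalog.Expressible H.HPartition := by
  obtain ⟨π, h | h⟩ := h
  · have : H.HPartition = fun V G =>
        (fullCycle k (some .dotted)).HPartition V (JoinProgram.effective G false) :=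
      funext fun V => funext fun G => propext (hPartition_iff_of_perm π h)
    rw [this]
    exact ⟨_, inferInstance, _, _, _, JoinProgram.stratifiedDecides false k⟩
  · have : H.HPartition = fun V G =>
        (fullCycle k (some .dotted)).HPartition V (JoinProgram.effective G true) :=
      funext fun V => funext fun G => propext (hPartition_iff_of_perm_swap π h)
    rw [this]
    exact ⟨_, inferInstance, _, _, _, JoinProgram.stratifiedDecides true k⟩

end ModelGraph

instance : Finite GeneralProgram.Sym :=
  Finite.of_surjective
    (![.full, .dotted, .eq, .distinct, .problematicBase, .base, .inPart, .done, .imp, .fullProb,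
      .dotProb, .badInit, .yesInstance, .noInstance] : Fin 14 → GeneralProgram.Sym) <| by
    rintro (_ | _ | _ | _ | _ | _ | _ | _ | _ | _ | _ | _ | _ | _)
    exacts [⟨0, rfl⟩, ⟨1, rfl⟩, ⟨2, rfl⟩, ⟨3, rfl⟩, ⟨4, rfl⟩, ⟨5, rfl⟩, ⟨6, rfl⟩, ⟨7, rfl⟩,
      ⟨8, rfl⟩, ⟨9, rfl⟩, ⟨10, rfl⟩, ⟨11, rfl⟩, ⟨12, rfl⟩, ⟨13, rfl⟩]

theorem mainTheorem1 (H : ModelGraph)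
    (h2K2 : ¬ H.Equivalent ModelGraph.twoK2)
    (hK2S2 : ¬ H.Equivalent ModelGraph.k2S2)
    (hC4 : ¬ H.Equivalent (ModelGraph.fullCycle none none)) :
    Datalog.Expressible H.HPartition ∧
    ((¬ H.Equivalent (ModelGraph.fullCycle none (some .dotted)) ∧
      ¬ H.Equivalent (ModelGraph.fullCycle (some .full) (some .dotted)) ∧
      ¬ H.Equivalent (ModelGraph.fullCycle (some .dotted) (some .dotted))) →
      Datalog.StratifiedDecides (GeneralProgram.program H) .yesInstance H.HPartition) := by
  have general : (¬ H.Equivalent (ModelGraph.fullCycle none (some .dotted)) ∧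
      ¬ H.Equivalent (ModelGraph.fullCycle (some .full) (some .dotted)) ∧
      ¬ H.Equivalent (ModelGraph.fullCycle (some .dotted) (some .dotted))) →
      Datalog.StratifiedDecides (GeneralProgram.program H) .yesInstance H.HPartition := by
    rintro ⟨h₁, h₂, h₃⟩
    obtain ⟨S, hS⟩ := ModelGraph.exists_isUniversal h2K2 hK2S2 hC4 h₁ h₂ h₃
    exact GeneralProgram.stratifiedDecides hS
  refine ⟨?_, general⟩
  -- The three remaining classes without a guaranteed universal set are the joins with one dotted
  -- diagonal, for the three values of `k`.
  by_cases h₁ : H.Equivalent (ModelGraph.fullCycle none (some .dotted))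
  · exact ModelGraph.expressible_of_equivalent h₁
  by_cases h₂ : H.Equivalent (ModelGraph.fullCycle (some .full) (some .dotted))
  · exact ModelGraph.expressible_of_equivalent h₂
  by_cases h₃ : H.Equivalent (ModelGraph.fullCycle (some .dotted) (some .dotted))
  · exact ModelGraph.expressible_of_equivalent h₃
  exact ⟨_, inferInstance, _, _, _, general ⟨h₁, h₂, h₃⟩⟩
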